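/- **Definitions.** A \emph{twin tree} $(T_\pm,\delta^*)$ consists of two trees $T_+,T_-$ and a symmetric function $\delta^*$ with values in $\mathbf N=\{0,1,2,\dots\}$ on pairs of vertices of opposite signs such that, if $\delta^*(x_+,y_-)=m$, then $\delta^*(x_+,y'_-)=m\pm1$ for every neighbour $y'_-$ of $y_-$, exactly one such $y'_-$ having $\delta^*(x_+,y'_-)=m+1$ when $m>0$; and likewise with $T_+$ and $T_-$ interchanged. It is \emph{thick} if all vertices have degree at least $3$, and \emph{locally finite} if all degrees are finite. Vertices of opposite signs are \emph{opposite} if their codistance is $0$. A \emph{twin apartment} $L$ is a pair of geodesic lines $L_\pm\subset T_\pm$ such that every vertex of $L_+\cup L_-$ has a unique opposite in it. Its vertices can be numbered $\{v_j^\epsilon\}_{j\in\mathbf Z}$ ($\epsilon=\pm$) so that $v_j^\epsilon,v_{j+1}^\epsilon$ are neighbours and $v_j^+,v_j^-$ are opposite. The two \emph{twin roots} with boundary $\{v_j^+,v_j^-\}$ are $\alpha_j=\{v_k^+\}_{k\ge j}\cup\{v_k^-\}_{k\le j}$ and $-\alpha_j=\{v_k^+\}_{k\le j}\cup\{v_k^-\}_{k\ge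 j}$; two twin roots of one twin apartment are \emph{prenilpotent} if their positive parts are nested. Let $A$ be the group of automorphisms of the twin tree (pairs of automorphisms of $T_+$ and $T_-$ preserving $\delta^*$). For a twin root $a$, $U_a\le A$ is the group of automorphisms fixing $a$ and every edge having a vertex in the interior of $a$. It is a \emph{root group} if it is transitive on the set of twin apartments containing $a$. The twin tree is \emph{Moufang} if in some twin apartment $U_a$ is a root group for every twin root $a$; then $\Lambda\le A$ denotes the group generated by all the $U_a$. Condition (Comm): $U_a$ and $U_b$ commute whenever $a\neq b$ are prenilpotent. A \emph{Nagao ray of groups} attaches finite groups $\Gamma_i$ to the vertices $x_i$ ($i\ge0$) of a ray, with $\Gamma_i\le\Gamma_{i+1}$ for $i>0$, and a common subgroup $H_0$ of $\Gamma_0$ and $\Gamma_1$, such that $[\Gamma_0:H_0]-1$, $[\Gamma_1:H_0]$ and $[\Gamma_{i+1}:\Gamma_i]$ ($i\ge1$) are all at least $2$; the edge group of $\{x_0,x_1\}$ is $H_0$ and that of $\{x_i,x_{i+1}\}$ is $\Gamma_i$ for $i>0$. A group acting on a tree is of \emph{Nagao type} if the group and its action identify with the fundamental group of such a ray of groups acting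 on its Bass–Serre tree. It is of \emph{directly split Nagao type} if moreover there are $H_0$-invariant subgroups $U_j\le\Gamma_j$ ($j>0$) with $\Gamma_i=H_0\ltimes(U_1\times\dots\times U_i)$ for all $i>0$. A vertex has \emph{level} $\ell(x)=i$ if it lies in the orbit of $x_i$. A $T$-\emph{lattice} is a discrete subgroup of finite covolume of $\mathrm{Aut}(T)$, with the topology of pointwise convergence. **Proposition.** Let $(T_\pm,\delta^*)$ be a thick locally finite Moufang twin tree, $L$ any twin apartment, with vertices numbered as above, $v_\pm=v_0^\pm$, $\Gamma=\mathrm{Stab}_\Lambda(v_-)$, $E_+=[v_0^+;v_1^+]$, $H_0=\mathrm{Stab}_\Gamma(E_+)$, and $U_j=U_{\alpha_j}$ for $j>0$. (i) Each of the two geodesic rays $\{v_j^+\}_{j\ge0}$ and $\{v_j^+\}_{j\le0}$ is a fundamental domain for the action of $\Gamma$ on $T_+$: every vertex (edge) of $T_+$ is in the $\Gamma$-orbit of exactly one vertex (edge) of the ray. (ii) $\mathrm{Stab}_A(E_+\cup\{v_-\})$ is finite, and in particular so is $H_0$. For each $j>0$, the set of products $U_1\cdots U_j$ is a subgroup and $\mathrm{Stab}_\Gamma(v_j^+)=H_0\ltimes(U_1\cdots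 U_j)$. The stabilizer $\mathrm{Stab}_\Gamma(v_0^+)$ is finite, and is generated by $H_0$, $U_{\alpha_0}$ and $U_{-\alpha_0}$. (iii) The groups $\Gamma_i=\mathrm{Stab}_\Gamma(v_i^+)$ ($i\ge0$) together with $H_0$ form a Nagao ray of groups, and $\Gamma$ with its action on $T_+$ identifies with the fundamental group of this ray of groups and its action on the Bass–Serre tree, compatibly with the subgroups $\Gamma_i$ and with the vertices $v_i^+$. (iv) $\Gamma$ is (that is, its image in $\mathrm{Aut}(T_+)$ is) a $T_+$-lattice, of Nagao type; it is of directly split Nagao type whenever (Comm) holds. (v) The level function with respect to the ray $\{v_j^+\}_{j\ge0}$ is the codistance from $v_-$: $\ell(x)=\delta^*(v_-,x)$ for every vertex $x$ of $T_+$. -/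

import Mathlib

open scoped Pointwise

universe u v w

/-! ## Groups acting on a tree -/

section Actions

variable {V : Type u} (T : SimpleGraph V) {Γ : Type w} [Group Γ]

/-- The topology of pointwise convergence on `Aut(T)` (the vertex set being discrete): the fixators
of finite sets of vertices form a basis of neighbourhoods of the identity. -/
instance autTopology : TopologicalSpace (T ≃g T) :=
  TopologicalSpace.induced (fun g : T ≃g T => (g : V → V))
    (@Pi.topologicalSpace V (fun _ => V) (fun _ => ⊥))

/-- The Borel σ-algebra on `Aut(T)`. -/
instance autMeasurableSpace : MeasurableSpace (T ≃g T) := borel (T ≃g T)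

/-- A `T`-lattice: a discrete subgroup of `Aut(T)` of finite covolume, i.e. admitting a fundamental
domain (for left translations) of finite Haar measure. (`IsHaarMeasure` is left-invariant; finiteness
of the covolume forces `Aut(T)` to be unimodular.) -/
def IsTreeLattice (Λ : Subgroup (T ≃g T)) : Prop :=
  DiscreteTopology Λ ∧
    ∃ μ : MeasureTheory.Measure (T ≃g T), μ.IsHaarMeasure ∧
      ∃ F : Set (T ≃g T), MeasureTheory.IsFundamentalDomain Λ F μ ∧ μ F < ⊤

variable {T}

/-- A subgraph `S` is a fundamental domain for an action on `T` if every vertex, and every edge, of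
`T` is in the orbit of exactly one vertex, respectively edge, of `S`. -/
def IsTreeFundamentalDomain (ρ : Γ →* (T ≃g T)) (S : T.Subgraph) : Prop :=
  (∀ x : V, ∃! s : V, s ∈ S.verts ∧ ∃ γ : Γ, ρ γ s = x) ∧
    ∀ e ∈ T.edgeSet, ∃! f : Sym2 V, f ∈ S.edgeSet ∧ ∃ γ : Γ, f.map (ρ γ) = e

/-- `x` has level `i` with respect to the ray `r` if it lies in the orbit of the vertex `r i`. -/
def HasLevel (ρ : Γ →* (T ≃g T)) (r : ℕ → V) (x : V) (i : ℕ) : Prop :=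
  ∃ γ : Γ, ρ γ (r i) = x

end Actions

/-! ## Internal products of subgroups -/

section Products

variable {P : Type w} [Group P]

/-- `K = H ⋉ N`, for subgroups of a group `P`. -/
def IsInternalSemidirect (K H N : Subgroup P) : Prop :=
  (∀ h ∈ H, ∀ n ∈ N, h * n * h⁻¹ ∈ N) ∧ Disjoint H N ∧ (H : Set P) * (N : Set P) = (K : Set P)

/-- `N` is the internal direct product of the subgroups `U i`. -/
def IsInternalDirectProduct {ι : Type} (U : ι → Subgroup P) (N : Subgroup P) : Prop :=
  (∀ i j, i ≠ j → ∀ a ∈ U i, ∀ b ∈ U j, Commute a b) ∧ iSupIndep U ∧ ⨆ i, U i = N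

/-- The set `U₁ ⋯ U_j` of the products `u₁ ⋯ u_j` with `u_k ∈ U_k`. -/
def productSet (U : ℤ → Subgroup P) : ℕ → Set P
  | 0 => 1
  | j + 1 => productSet U j * (U (j + 1 : ℕ) : Set P)

end Products

/-! ## Lattices of Nagao type -/

/-- A ray of finite groups `Γ₀ ⊇ H₀ ⊆ Γ₁ ⊆ Γ₂ ⊆ ⋯` with `[Γ₀ : H₀] - 1`, `[Γ₁ : H₀]` and
`[Γ_{i+1} : Γ_i]` all at least `2`. The ambient group `P` only serves to express the inclusions: any
such ray of groups is realised inside its fundamental group. -/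
structure NagaoRay (P : Type w) [Group P] where
  vert : ℕ → Subgroup P
  H0 : Subgroup P
  H0_le_zero : H0 ≤ vert 0
  H0_le_one : H0 ≤ vert 1
  vert_le : ∀ i, 0 < i → vert i ≤ vert (i + 1)
  finite_vert : ∀ i, Finite (vert i)
  index_zero : 2 ≤ H0.relIndex (vert 0) - 1
  index_one : 2 ≤ H0.relIndex (vert 1)
  index_succ : ∀ i, 0 < i → 2 ≤ (vert i).relIndex (vert (i + 1))

namespace NagaoRay

variable {P : Type w} [Group P] (D : NagaoRay P)

/-- The group attached to the edge `{x_i, x_{i+1}}` of the ray. -/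
def edge : ℕ → Subgroup P
  | 0 => D.H0
  | i + 1 => D.vert (i + 1)

theorem edge_le_left : ∀ i, D.edge i ≤ D.vert i
  | 0 => D.H0_le_zero
  | _ + 1 => le_refl _

theorem edge_le_right : ∀ i, D.edge i ≤ D.vert (i + 1)
  | 0 => D.H0_le_one
  | i + 1 => D.vert_le (i + 1) (Nat.succ_pos i)

/-- The relations identifying the two copies of each edge group in the free product of the vertex
groups. -/
def relators : Set (Monoid.CoprodI fun i => D.vert i) :=
  {r | ∃ (i : ℕ) (h : D.edge i),
    r = Monoid.CoprodI.of (M := fun i => D.vert i) (i := i)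
          (Subgroup.inclusion (D.edge_le_left i) h) *
        (Monoid.CoprodI.of (M := fun i => D.vert i) (i := i + 1)
          (Subgroup.inclusion (D.edge_le_right i) h))⁻¹}

/-- The fundamental group of the ray of groups: the amalgam of the vertex groups along the edge
groups. -/
abbrev π₁ : Type w :=
  (Monoid.CoprodI fun i => D.vert i) ⧸ Subgroup.normalClosure D.relators

/-- The canonical map of a vertex group into the fundamental group. -/
def ι (i : ℕ) : D.vert i →* D.π₁ :=
  (QuotientGroup.mk' (Subgroup.normalClosure D.relators)).comp
    (Monoid.CoprodI.of (M := fun i => D.vert i) (i := i))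

/-- The vertices of the Bass–Serre tree: the cosets of the vertex groups. -/
abbrev TreeVertex : Type w := Σ i : ℕ, D.π₁ ⧸ (D.ι i).range

/-- The vertex `gΓ_i` of the Bass–Serre tree. -/
def vertex (g : D.π₁) (i : ℕ) : D.TreeVertex := ⟨i, (g : D.π₁ ⧸ (D.ι i).range)⟩

/-- The Bass–Serre tree of the ray of groups: its edges join `gΓ_i` and `gΓ_{i+1}`. The group `π₁`
acts on its vertices by left translation. -/
def tree : SimpleGraph D.TreeVertex where
  Adj a b := ∃ (g : D.π₁) (i : ℕ),
    (a = D.vertex g i ∧ b = D.vertex g (i + 1)) ∨ (a = D.vertex g (i + 1) ∧ b = D.vertex g i)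
  symm := ⟨by
    rintro a b ⟨g, i, h | h⟩
    · exact ⟨g, i, Or.inr ⟨h.2, h.1⟩⟩
    · exact ⟨g, i, Or.inl ⟨h.2, h.1⟩⟩⟩
  loopless := ⟨by
    rintro a ⟨g, i, ⟨h, h'⟩ | ⟨h, h'⟩⟩ <;>
    · have := congrArg Sigma.fst (h.symm.trans h')
      simp [vertex] at this⟩

/-- `Γ_i = H₀ ⋉ (U₁ × ⋯ × U_i)` for all `i > 0`, for suitable `H₀`-invariant subgroups
`U_j ≤ Γ_j`. -/
def IsDirectlySplit : Prop :=
  ∃ U : ℕ → Subgroup P,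
    (∀ j, 0 < j → U j ≤ D.vert j ∧ ∀ h ∈ D.H0, ∀ a ∈ U j, h * a * h⁻¹ ∈ U j) ∧
    ∀ i, 0 < i → ∃ N : Subgroup P,
      IsInternalDirectProduct (fun j : Fin i => U ((j : ℕ) + 1)) N ∧
      IsInternalSemidirect (D.vert i) D.H0 N

/-- The group `Γ` and its action `ρ` on `T` identify with the fundamental group of the ray of groups
and its action on the Bass–Serre tree; each group `Γ_i` corresponds to itself, and the `i`-th vertex
of the standard ray to `x i`. -/
def Realizes {Γ : Type w} [Group Γ] (D : NagaoRay Γ) {V : Type u} {T : SimpleGraph V}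
    (ρ : Γ →* (T ≃g T)) (x : ℕ → V) : Prop :=
  ∃ (φ : D.π₁ ≃* Γ) (ψ : D.tree ≃g T),
    (∀ (i : ℕ) (g : D.vert i), φ (D.ι i g) = g) ∧
    (∀ i : ℕ, ψ (D.vertex 1 i) = x i) ∧
    ∀ (g : D.π₁) (a : D.TreeVertex), ψ (g • a) = ρ (φ g) (ψ a)

end NagaoRay

/-- The group `Γ`, acting on `T` through `ρ`, is of Nagao type: it is the fundamental group of a ray
of groups as above, acting on the corresponding Bass–Serre tree. The vertex groups are identified
with subgroups of `Γ`. -/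
def IsNagaoType {Γ : Type w} [Group Γ] {V : Type u} {T : SimpleGraph V} (ρ : Γ →* (T ≃g T)) : Prop :=
  ∃ (D : NagaoRay Γ) (x : ℕ → V), D.Realizes ρ x

/-- The group `Γ`, acting on `T` through `ρ`, is of directly split Nagao type: the vertex
groups of such a ray of groups moreover split as `H₀ ⋉ (U₁ × ⋯ × U_i)`. -/
def IsDirectlySplitNagaoType {Γ : Type w} [Group Γ] {V : Type u} {T : SimpleGraph V}
    (ρ : Γ →* (T ≃g T)) : Prop :=
  ∃ (D : NagaoRay Γ) (x : ℕ → V), D.Realizes ρ x ∧ D.IsDirectlySplit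

/-! ## Twin trees -/

/-- A twin tree: two trees related by a codistance. -/
structure TwinTree (Vp : Type u) (Vm : Type v) where
  pos : SimpleGraph Vp
  neg : SimpleGraph Vm
  isTree_pos : pos.IsTree
  isTree_neg : neg.IsTree
  codist : Vp → Vm → ℕ
  codist_neg : ∀ x y y', neg.Adj y y' →
    codist x y' = codist x y + 1 ∨ codist x y' + 1 = codist x y
  codist_neg_unique : ∀ x y, 0 < codist x y →
    ∃! y', neg.Adj y y' ∧ codist x y' = codist x y + 1
  codist_pos : ∀ x x' y, pos.Adj x x' →
    codist x' y = codist x y + 1 ∨ codist x' y + 1 = codist x y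
  codist_pos_unique : ∀ x y, 0 < codist x y →
    ∃! x', pos.Adj x x' ∧ codist x' y = codist x y + 1

/-- A geodesic line in a graph, as a set of vertices. -/
def IsGeodesicLine {V : Type u} (T : SimpleGraph V) (L : Set V) : Prop :=
  ∃ f : ℤ → V, (∀ i j : ℤ, T.dist (f i) (f j) = (i - j).natAbs) ∧ Set.range f = L

namespace TwinTree

variable {Vp : Type u} {Vm : Type v} (𝒯 : TwinTree Vp Vm)

/-- All vertices have degree at least `3`. -/
def IsThick : Prop :=
  (∀ x, 3 ≤ (𝒯.pos.neighborSet x).encard) ∧ ∀ y, 3 ≤ (𝒯.neg.neighborSet y).encard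

/-- All vertices have finite degree. -/
def IsLocallyFinite : Prop :=
  (∀ x, (𝒯.pos.neighborSet x).Finite) ∧ ∀ y, (𝒯.neg.neighborSet y).Finite

/-- The automorphism group of the twin tree: the pairs of automorphisms preserving the
codistance. -/
def Aut : Subgroup ((𝒯.pos ≃g 𝒯.pos) × (𝒯.neg ≃g 𝒯.neg)) where
  carrier := {g | ∀ x y, 𝒯.codist (g.1 x) (g.2 y) = 𝒯.codist x y}
  one_mem' := fun _ _ => rfl
  mul_mem' := fun {g h} hg hh x y => (hg (h.1 x) (h.2 y)).trans (hh x y)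
  inv_mem' := fun {g} hg x y => by
    have h := hg (g⁻¹.1 x) (g⁻¹.2 y)
    have h1 : g.1 (g⁻¹.1 x) = x := g.1.apply_symm_apply x
    have h2 : g.2 (g⁻¹.2 y) = y := g.2.apply_symm_apply y
    rw [h1, h2] at h
    exact h.symm

/-- The action of the automorphism group on the positive tree. -/
def toAutPos : 𝒯.Aut →* (𝒯.pos ≃g 𝒯.pos) := (MonoidHom.fst _ _).comp 𝒯.Aut.subtype

/-- The action of the automorphism group on the negative tree. -/
def toAutNeg : 𝒯.Aut →* (𝒯.neg ≃g 𝒯.neg) := (MonoidHom.snd _ _).comp 𝒯.Aut.subtype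

instance : MulAction 𝒯.Aut Vp where
  smul g x := 𝒯.toAutPos g x
  one_smul _ := rfl
  mul_smul _ _ _ := rfl

instance : MulAction 𝒯.Aut Vm where
  smul g y := 𝒯.toAutNeg g y
  one_smul _ := rfl
  mul_smul _ _ _ := rfl

/-- A twin apartment: a pair of geodesic lines in which every vertex has a unique opposite. -/
structure TwinApartment where
  pos : Set Vp
  neg : Set Vm
  isGeodesicLine_pos : IsGeodesicLine 𝒯.pos pos
  isGeodesicLine_neg : IsGeodesicLine 𝒯.neg neg
  unique_opposite_pos : ∀ x ∈ pos, ∃! y, y ∈ neg ∧ 𝒯.codist x y = 0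
  unique_opposite_neg : ∀ y ∈ neg, ∃! x, x ∈ pos ∧ 𝒯.codist x y = 0

variable {𝒯}

/-- A numbering `p j = v_j^+`, `m j = v_j^-` of the vertices of a twin apartment such that vertices
with consecutive numbers are neighbours and vertices with the same number are opposite. Every twin
apartment has numberings, any two of which differ by an automorphism of `ℤ`. -/
structure TwinApartment.Numbering (L : 𝒯.TwinApartment) where
  p : ℤ → Vp
  m : ℤ → Vm
  p_injective : Function.Injective p
  m_injective : Function.Injective m
  range_p : Set.range p = L.pos
  range_m : Set.range m = L.neg
  adj_p : ∀ j, 𝒯.pos.Adj (p j) (p (j + 1))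
  adj_m : ∀ j, 𝒯.neg.Adj (m j) (m (j + 1))
  opposite : ∀ j, 𝒯.codist (p j) (m j) = 0

namespace TwinApartment.Numbering

variable {L : 𝒯.TwinApartment} (N : L.Numbering)

/-- The reversed numbering. -/
def reverse : L.Numbering where
  p j := N.p (-j)
  m j := N.m (-j)
  p_injective := N.p_injective.comp neg_injective
  m_injective := N.m_injective.comp neg_injective
  range_p := (neg_surjective.range_comp N.p).trans N.range_p
  range_m := (neg_surjective.range_comp N.m).trans N.range_m
  adj_p j := by
    have h := (N.adj_p (-(j + 1))).symm
    rwa [show -(j + 1) + 1 = -j by ring] at h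
  adj_m j := by
    have h := (N.adj_m (-(j + 1))).symm
    rwa [show -(j + 1) + 1 = -j by ring] at h
  opposite j := N.opposite (-j)

/-- The twin root with boundary `{v_j^+, v_j^-}` containing the vertices `v_k^+` with `k ≥ j`: in
the double cone over the apartment, where `v_k^-` is the negative of `v_k^+`, this half-plane
contains the vertices `v_k^-` with `k ≤ j`. The other twin root with this boundary is
`N.reverse.root (-j)`. -/
def root (j : ℤ) : Set Vp × Set Vm := (N.p '' Set.Ici j, N.m '' Set.Iic j)

/-- The group `U_a`, for `a = N.root j`: the automorphisms of the twin tree which fix `a` and every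
edge having a vertex in the interior of `a`. -/
def rootGroup (j : ℤ) : Subgroup 𝒯.Aut where
  carrier := {g |
    (∀ x ∈ (N.root j).1, g • x = x) ∧ (∀ y ∈ (N.root j).2, g • y = y) ∧
    (∀ k, j < k → ∀ x, 𝒯.pos.Adj (N.p k) x → g • x = x) ∧
    (∀ k, k < j → ∀ y, 𝒯.neg.Adj (N.m k) y → g • y = y)}
  one_mem' := ⟨fun _ _ => one_smul _ _, fun _ _ => one_smul _ _, fun _ _ _ _ => one_smul _ _,
    fun _ _ _ _ => one_smul _ _⟩
  mul_mem' := by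
    rintro g h ⟨g1, g2, g3, g4⟩ ⟨h1, h2, h3, h4⟩
    refine ⟨fun x hx => ?_, fun x hx => ?_, fun k hk x hx => ?_, fun k hk x hx => ?_⟩
    · rw [mul_smul, h1 x hx, g1 x hx]
    · rw [mul_smul, h2 x hx, g2 x hx]
    · rw [mul_smul, h3 k hk x hx, g3 k hk x hx]
    · rw [mul_smul, h4 k hk x hx, g4 k hk x hx]
  inv_mem' := by
    rintro g ⟨g1, g2, g3, g4⟩
    refine ⟨fun x hx => ?_, fun x hx => ?_, fun k hk x hx => ?_, fun k hk x hx => ?_⟩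
    · rw [inv_smul_eq_iff, g1 x hx]
    · rw [inv_smul_eq_iff, g2 x hx]
    · rw [inv_smul_eq_iff, g3 k hk x hx]
    · rw [inv_smul_eq_iff, g4 k hk x hx]

/-- `U_a` is a root group, for `a = N.root j`: it is transitive on the twin apartments containing
`a`. -/
def IsRootGroup (j : ℤ) : Prop :=
  ∀ L₁ L₂ : 𝒯.TwinApartment,
    (N.root j).1 ⊆ L₁.pos → (N.root j).2 ⊆ L₁.neg →
    (N.root j).1 ⊆ L₂.pos → (N.root j).2 ⊆ L₂.neg →
    ∃ g ∈ N.rootGroup j, g • L₁.pos = L₂.pos ∧ g • L₁.neg = L₂.neg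

end TwinApartment.Numbering

variable (𝒯)

/-- The Moufang property: in some twin apartment, `U_a` is a root group for every twin root `a`.
(The twin roots in `L` are the `N.root j` for all numberings `N` of `L` and all `j`.) -/
def IsMoufang : Prop :=
  ∃ L : 𝒯.TwinApartment, ∀ (N : L.Numbering) (j : ℤ), N.IsRootGroup j

/-- The group `Λ` generated by all root groups. -/
def rootSubgroup : Subgroup 𝒯.Aut :=
  ⨆ (L : 𝒯.TwinApartment) (N : L.Numbering) (j : ℤ), N.rootGroup j

/-- Condition (Comm): the root groups of any two different prenilpotent twin roots (i.e. twin roots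
in a common twin apartment whose positive parts are nested) commute. -/
def SatisfiesComm : Prop :=
  ∀ (L : 𝒯.TwinApartment) (N N' : L.Numbering) (i j : ℤ), N.root i ≠ N'.root j →
    ((N.root i).1 ⊆ (N'.root j).1 ∨ (N'.root j).1 ⊆ (N.root i).1) →
    ∀ a ∈ N.rootGroup i, ∀ b ∈ N'.rootGroup j, Commute a b

/-- The subgraph of the positive tree spanned by a set of vertices. -/
def posSpan (s : Set Vp) : 𝒯.pos.Subgraph := (⊤ : 𝒯.pos.Subgraph).induce s

end TwinTree

/-!
The proof works with frames, i.e. twin apartments numbered so that the codistance between `v_i^+` and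
`v_j^-` is `|i - j|`. Since a vertex at positive codistance has only one neighbour further away, a
frame is determined by two opposite edges, and any two opposite edges lie in a frame
(`TwinTree.Frame.exists_of_opposite_edges`). Hence the root groups of a twin apartment as in the
definition of the Moufang property are transitive on the edges leaving the twin root at its boundary.
Moving a frame along paths, first in the positive and then in the negative tree, one sees that this
local transitivity holds in every twin apartment (`TwinTree.Frame.Moufang.of_frame`).

Let `Γ` be the stabilizer of `v_0^-`. It contains `U_{α_j}` for `j ≥ 0` and `U_{-α_0}`. If `n > 0`,
the group `U_{α_n}` fixes the only neighbour of `v_n^+` at codistance `n + 1` from `v_0^-` and is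
transitive on the others; by thickness, the two root groups at `v_0^+` together are transitive on the
neighbours of `v_0^+`. By induction along paths, the codistance from `v_0^-` classifies the orbits of
`Γ` on vertices and edges (`TwinTree.Frame.IsVertexGroup.isTreeFundamentalDomain`).

The second ingredient is rigidity: an automorphism fixing two opposite edges and all edges meeting
one of them is trivial (`TwinTree.IsThick.eq_one_of_fixes`). It gives the finiteness of the
stabilizers. An element of `Γ` fixing `v_j^+` fixes the ray from `v_j^+` on, and can be corrected
successively by elements of `U_{α_j}, …, U_{α_1}` to one that fixes the whole ray. The product
`U_{α_1} ⋯ U_{α_j}` is a subgroup because, by the same argument and rigidity, it consists of all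
automorphisms fixing the ray from `v_j^+` on, the edges at its interior vertices, and the edges at
the vertices `v_k^-` with `k ≤ 0`; this description is invariant under `H₀`. No commutator relations
between root groups are needed.

Two general facts finish the proof. A group acting on a tree with a ray as fundamental domain is the
fundamental group of the ray of its vertex stabilizers (`NagaoRay.realizes_of_isTree`), as the
equivariant map from the Bass–Serre tree is locally bijective. And a group of automorphisms of a
locally finite tree with a sequence of orbit representatives whose stabilizers are finite of
exponentially growing orders is a lattice (`SimpleGraph.Connected.isTreeLattice`): each
representative contributes to the covolume at most a constant divided by the order of its stabilizer.
-/

/-! ### Codistances along paths -/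

namespace TwinTree

variable {Vp : Type u} {Vm : Type v} (𝒯 : TwinTree Vp Vm)

/-- The twin tree with the two trees interchanged. -/
def swap : TwinTree Vm Vp where
  pos := 𝒯.neg
  neg := 𝒯.pos
  isTree_pos := 𝒯.isTree_neg
  isTree_neg := 𝒯.isTree_pos
  codist y x := 𝒯.codist x y
  codist_neg y x x' h := 𝒯.codist_pos x x' y h
  codist_neg_unique y x h := 𝒯.codist_pos_unique x y h
  codist_pos y y' x h := 𝒯.codist_neg x y y' h
  codist_pos_unique y x h := 𝒯.codist_neg_unique x y h

variable {𝒯}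

theorem eq_of_codist_pos_succ {x a b : Vp} {y : Vm} (h : 0 < 𝒯.codist x y)
    (ha : 𝒯.pos.Adj x a) (hb : 𝒯.pos.Adj x b) (ha' : 𝒯.codist a y = 𝒯.codist x y + 1)
    (hb' : 𝒯.codist b y = 𝒯.codist x y + 1) : a = b :=
  (𝒯.codist_pos_unique x y h).unique ⟨ha, ha'⟩ ⟨hb, hb'⟩

theorem eq_of_codist_neg_succ {x : Vp} {y a b : Vm} (h : 0 < 𝒯.codist x y)
    (ha : 𝒯.neg.Adj y a) (hb : 𝒯.neg.Adj y b) (ha' : 𝒯.codist x a = 𝒯.codist x y + 1)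
    (hb' : 𝒯.codist x b = 𝒯.codist x y + 1) : a = b :=
  (𝒯.codist_neg_unique x y h).unique ⟨ha, ha'⟩ ⟨hb, hb'⟩

/-- A ray which starts at a vertex opposite to `y`, does not backtrack and meets no other vertex
opposite to `y` moves away from `y`: a first step towards `y` would have to be followed by further
steps towards `y`, until a second opposite vertex is reached. -/
theorem codist_ray (f : ℕ → Vp) (y : Vm) (hadj : ∀ n, 𝒯.pos.Adj (f n) (f (n + 1)))
    (hne : ∀ n, f (n + 2) ≠ f n) (h0 : 𝒯.codist (f 0) y = 0)
    (hpos : ∀ n, 𝒯.codist (f (n + 1)) y ≠ 0) (n : ℕ) : 𝒯.codist (f n) y = n := by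
  have desc : ∀ a, 𝒯.codist (f (a + 1)) y + 1 = 𝒯.codist (f a) y →
      ∀ k, k + 1 ≤ 𝒯.codist (f a) y →
        𝒯.codist (f (a + k + 1)) y + 1 = 𝒯.codist (f (a + k)) y ∧
        𝒯.codist (f (a + k + 1)) y + (k + 1) = 𝒯.codist (f a) y := by
    intro a ha k
    induction k with
    | zero => intro _; exact ⟨ha, ha⟩
    | succ k ih =>
      intro hk
      obtain ⟨h1, h2⟩ := ih (by omega)
      have h3 : 𝒯.codist (f (a + k + 1 + 1)) y + 1 = 𝒯.codist (f (a + k + 1)) y := by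
        rcases 𝒯.codist_pos _ _ y (hadj (a + k + 1)) with h | h
        · exact absurd (eq_of_codist_pos_succ (by omega) (hadj (a + k + 1))
            (hadj (a + k)).symm h h1.symm) (hne (a + k))
        · exact h
      exact ⟨h3, by rw [← add_assoc a k 1]; omega⟩
  have up : ∀ a, 𝒯.codist (f (a + 1)) y = 𝒯.codist (f a) y + 1 := by
    intro a
    rcases 𝒯.codist_pos _ _ y (hadj a) with h | h
    · exact h
    · have := (desc a h (𝒯.codist (f a) y - 1) (by omega)).2
      exact absurd (by omega) (hpos (a + (𝒯.codist (f a) y - 1)))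
  induction n with
  | zero => exact h0
  | succ n ih => rw [up, ih]

theorem codist_le_add (f : ℕ → Vp) (y : Vm) (hadj : ∀ n, 𝒯.pos.Adj (f n) (f (n + 1))) (n : ℕ) :
    𝒯.codist (f 0) y ≤ 𝒯.codist (f n) y + n := by
  induction n with
  | zero => simp
  | succ n ih => rcases 𝒯.codist_pos _ _ y (hadj n) with h | h <;> omega

/-- A ray moving away from `y` also moves away from any neighbour `y'` of `y` that is opposite to its
first vertex. -/
theorem codist_ray_neighbor (f : ℕ → Vp) {y y' : Vm} (hadj : ∀ n, 𝒯.pos.Adj (f n) (f (n + 1)))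
    (hy : 𝒯.neg.Adj y y') (h : ∀ n, 𝒯.codist (f n) y = n + 1) (h0 : 𝒯.codist (f 0) y' = 0)
    (n : ℕ) : 𝒯.codist (f n) y' = n := by
  induction n with
  | zero => exact h0
  | succ n ih =>
    have h1 := 𝒯.codist_pos _ _ y' (hadj n)
    have h2 := 𝒯.codist_neg (f (n + 1)) _ _ hy
    have := h (n + 1)
    omega

/-- If the neighbour `x'` of `x` is further away from `y'`, and `x` is further away from `y'` than
from its neighbour `y`, then `x'` is also further away from `y`. -/
theorem codist_succ_of_codist_succ {x x' : Vp} {y y' : Vm} (hy : 𝒯.neg.Adj y y')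
    (hx : 𝒯.pos.Adj x x') (h : 𝒯.codist x y' = 𝒯.codist x y + 1)
    (h' : 𝒯.codist x' y' = 𝒯.codist x y' + 1) : 𝒯.codist x' y = 𝒯.codist x y + 1 := by
  have h1 := 𝒯.codist_pos _ _ y hx
  have h2 := 𝒯.codist_neg x' _ _ hy
  omega

/-- Every vertex with positive codistance from `y` starts a ray moving away from `y`. -/
theorem exists_ray (x : Vp) (y : Vm) (h : 0 < 𝒯.codist x y) :
    ∃ f : ℕ → Vp, f 0 = x ∧ (∀ n, 𝒯.pos.Adj (f n) (f (n + 1))) ∧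
      ∀ n, 𝒯.codist (f n) y = 𝒯.codist x y + n := by
  classical
  let F : ℕ → {z : Vp // 0 < 𝒯.codist z y} := fun n => Nat.rec ⟨x, h⟩ (fun _ z =>
    ⟨(𝒯.codist_pos_unique z.1 y z.2).choose, by
      rw [(𝒯.codist_pos_unique z.1 y z.2).choose_spec.1.2]; omega⟩) n
  have hF : ∀ n, 𝒯.pos.Adj (F n).1 (F (n + 1)).1 ∧
      𝒯.codist (F (n + 1)).1 y = 𝒯.codist (F n).1 y + 1 := fun n =>
    (𝒯.codist_pos_unique (F n).1 y (F n).2).choose_spec.1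
  refine ⟨fun n => (F n).1, rfl, fun n => (hF n).1, fun n => ?_⟩
  induction n with
  | zero => rfl
  | succ n ih => rw [(hF n).2, ih]; rfl

/-! ### Numbered twin apartments -/

variable (𝒯) in
/-- A twin apartment together with a numbering of its vertices, encoded by the codistances
`δ*(v_i^+, v_j^-) = |i - j|` between its vertices. -/
@[ext]
structure Frame where
  p : ℤ → Vp
  m : ℤ → Vm
  adj_p : ∀ j, 𝒯.pos.Adj (p j) (p (j + 1))
  adj_m : ∀ j, 𝒯.neg.Adj (m j) (m (j + 1))
  codist_eq : ∀ i j, 𝒯.codist (p i) (m j) = (i - j).natAbs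

namespace Frame

/-- The frame with the numbering translated by `n`. -/
def shift (F : 𝒯.Frame) (n : ℤ) : 𝒯.Frame where
  p j := F.p (j + n)
  m j := F.m (j + n)
  adj_p j := by have := F.adj_p (j + n); rwa [show j + n + 1 = j + 1 + n by ring] at this
  adj_m j := by have := F.adj_m (j + n); rwa [show j + n + 1 = j + 1 + n by ring] at this
  codist_eq i j := by rw [F.codist_eq]; congr 1; ring

theorem adj_p_sub (F : 𝒯.Frame) (j : ℤ) : 𝒯.pos.Adj (F.p j) (F.p (j - 1)) := by
  have := (F.adj_p (j - 1)).symm; rwa [sub_add_cancel] at this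

theorem adj_m_sub (F : 𝒯.Frame) (j : ℤ) : 𝒯.neg.Adj (F.m j) (F.m (j - 1)) := by
  have := (F.adj_m (j - 1)).symm; rwa [sub_add_cancel] at this

/-- The frame with the reversed numbering. -/
def reverse (F : 𝒯.Frame) : 𝒯.Frame where
  p j := F.p (-j)
  m j := F.m (-j)
  adj_p j := by have := F.adj_p_sub (-j); rwa [show -j - 1 = -(j + 1) by ring] at this
  adj_m j := by have := F.adj_m_sub (-j); rwa [show -j - 1 = -(j + 1) by ring] at this
  codist_eq i j := by rw [F.codist_eq]; omega

/-- The frame with the two lines interchanged. -/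
def swap (F : 𝒯.Frame) : 𝒯.swap.Frame where
  p := F.m
  m := F.p
  adj_p := F.adj_m
  adj_m := F.adj_p
  codist_eq i j := by
    have := F.codist_eq j i
    simp only [TwinTree.swap]
    omega

@[simp] theorem reverse_p (F : 𝒯.Frame) (j : ℤ) : F.reverse.p j = F.p (-j) := rfl
@[simp] theorem reverse_m (F : 𝒯.Frame) (j : ℤ) : F.reverse.m j = F.m (-j) := rfl
@[simp] theorem shift_p (F : 𝒯.Frame) (n j : ℤ) : (F.shift n).p j = F.p (j + n) := rfl
@[simp] theorem shift_m (F : 𝒯.Frame) (n j : ℤ) : (F.shift n).m j = F.m (j + n) := rfl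

@[simp] theorem reverse_reverse (F : 𝒯.Frame) : F.reverse.reverse = F := by
  ext j <;> simp

theorem p_injective (F : 𝒯.Frame) : Function.Injective F.p := fun i j h => by
  have h1 := F.codist_eq i j
  have h2 := F.codist_eq j j
  rw [h] at h1; omega

theorem m_injective (F : 𝒯.Frame) : Function.Injective F.m := F.swap.p_injective

theorem adj_p_iff (F : 𝒯.Frame) {i j : ℤ} (h : 𝒯.pos.Adj (F.p i) (F.p j)) :
    j = i + 1 ∨ j = i - 1 := by
  have h1 := F.codist_eq i i
  have h2 := F.codist_eq j i
  have h3 := 𝒯.codist_pos _ _ (F.m i) h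
  omega

theorem adj_m_iff (F : 𝒯.Frame) {i j : ℤ} (h : 𝒯.neg.Adj (F.m i) (F.m j)) :
    j = i + 1 ∨ j = i - 1 := F.swap.adj_p_iff h

/-- The vertex `p (i + 1)` is determined by `p i` and `m j` for `j < i`, and so is the whole ray. -/
theorem eq_p_of_le {F F' : 𝒯.Frame} {i j : ℤ} (hp : F.p i = F'.p i) (hm : F.m j = F'.m j)
    (hij : j < i) {k : ℤ} (hk : i ≤ k) : F.p k = F'.p k := by
  induction k, hk using Int.leInduction with
  | base => exact hp
  | succ k hk ih =>
    have h1 := F.codist_eq k j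
    have h2 := F.codist_eq (k + 1) j
    have h3 := F'.codist_eq (k + 1) j
    rw [← hm] at h3
    have h4 := F'.adj_p k
    rw [← ih] at h4
    exact eq_of_codist_pos_succ (y := F.m j) (by omega) (F.adj_p k) h4 (by omega) (by omega)

theorem eq_p_of_ge {F F' : 𝒯.Frame} {i j : ℤ} (hp : F.p i = F'.p i) (hm : F.m j = F'.m j)
    (hij : i < j) {k : ℤ} (hk : k ≤ i) : F.p k = F'.p k := by
  have := eq_p_of_le (F := F.reverse) (F' := F'.reverse) (i := -i) (j := -j) (k := -k)
    (by simpa using hp) (by simpa using hm) (by omega) (by omega)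
  simpa using this

theorem eq_m_of_le {F F' : 𝒯.Frame} {i j : ℤ} (hp : F.p i = F'.p i) (hm : F.m j = F'.m j)
    (hij : i < j) {k : ℤ} (hk : j ≤ k) : F.m k = F'.m k :=
  eq_p_of_le (F := F.swap) (F' := F'.swap) hm hp hij hk

theorem eq_m_of_ge {F F' : 𝒯.Frame} {i j : ℤ} (hp : F.p i = F'.p i) (hm : F.m j = F'.m j)
    (hij : j < i) {k : ℤ} (hk : k ≤ j) : F.m k = F'.m k :=
  eq_p_of_ge (F := F.swap) (F' := F'.swap) hm hp hij hk

/-- A frame is determined by two opposite edges. -/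
theorem eq_of_opposite_edges {F F' : 𝒯.Frame} {j : ℤ} (h0 : F.p j = F'.p j)
    (h1 : F.p (j + 1) = F'.p (j + 1)) (h2 : F.m j = F'.m j) (h3 : F.m (j + 1) = F'.m (j + 1)) :
    F = F' := by
  ext k
  · rcases le_or_gt k j with h | h
    · exact eq_p_of_ge h0 h3 (by omega) h
    · exact eq_p_of_le h1 h2 (by omega) h
  · rcases le_or_gt k j with h | h
    · exact eq_m_of_ge h1 h2 (by omega) h
    · exact eq_m_of_le h0 h3 (by omega) h

/-- Half of the codistances in a frame, from those to two consecutive vertices of either line. -/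
theorem codist_eq_of_nonneg {p : ℤ → Vp} {m : ℤ → Vm} (hp : ∀ j, 𝒯.pos.Adj (p j) (p (j + 1)))
    (hm : ∀ j, 𝒯.neg.Adj (m j) (m (j + 1)))
    (hm0 : ∀ i, 𝒯.codist (p i) (m 0) = (i - 0).natAbs)
    (hm1 : ∀ i, 𝒯.codist (p i) (m 1) = (i - 1).natAbs)
    (hp0 : ∀ j, 𝒯.codist (p 0) (m j) = (0 - j).natAbs)
    (n : ℕ) : (∀ i, 𝒯.codist (p i) (m n) = (i - n).natAbs) ∧
      ∀ i, 𝒯.codist (p i) (m (n + 1)) = (i - (n + 1)).natAbs := by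
  induction n with
  | zero => exact ⟨by simpa using hm0, by simpa using hm1⟩
  | succ n ih =>
    obtain ⟨ih0, ih1⟩ := ih
    push_cast
    refine ⟨ih1, ?_⟩
    have hadj := hm (n + 1)
    have hadj' := (hm n).symm
    have hne : m (n + 1 + 1) ≠ m n := by
      intro h
      have h1 := hp0 (n + 1 + 1)
      have h2 := hp0 n
      rw [h] at h1; omega
    have hgt : ∀ i : ℤ, n + 1 < i → 𝒯.codist (p i) (m (n + 1 + 1)) = (i - (n + 1 + 1)).natAbs := by
      intro i hi
      have h1 := ih0 i
      have h2 := ih1 i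
      have h3 := 𝒯.codist_neg (p i) _ _ hadj
      have h4 : 𝒯.codist (p i) (m (n + 1 + 1)) ≠ 𝒯.codist (p i) (m (n + 1)) + 1 := fun h =>
        hne (eq_of_codist_neg_succ (by omega) hadj hadj' h (by omega))
      omega
    have h1 : 𝒯.codist (p (n + 1)) (m (n + 1 + 1)) = 1 := by
      have h2 := ih1 (n + 1)
      have h3 := 𝒯.codist_neg (p (n + 1)) _ _ hadj
      omega
    have h2 : 𝒯.codist (p n) (m (n + 1 + 1)) = 2 := by
      have h3 := 𝒯.codist_neg (p n) _ _ hadj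
      have h4 := ih1 n
      have h5 := codist_le_add (fun k : ℕ => p k) (m (n + 1 + 1))
        (fun k => by push_cast; exact hp k) n
      have h6 := hp0 (n + 1 + 1)
      simp only [Nat.cast_zero] at h5
      omega
    have hle : ∀ k : ℕ, 𝒯.codist (p (n - k)) (m (n + 1 + 1)) = k + 2 := by
      intro k
      induction k with
      | zero => simpa using h2
      | succ k ihk =>
        -- the neighbour of `p (n - k)` further away from `m (n + 2)` is also further away from
        -- `m (n + 1)`, hence is the previous vertex of the line
        obtain ⟨z, ⟨hz, hz'⟩, -⟩ := 𝒯.codist_pos_unique (p (n - k)) (m (n + 1 + 1)) (by omega)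
        have h3 := ih1 (n - k)
        have h4 := codist_succ_of_codist_succ hadj hz (by omega) hz'
        have h5 := hp (n - k - 1)
        rw [sub_add_cancel] at h5
        have h6 := ih1 (n - k - 1)
        have h7 := eq_of_codist_pos_succ (by omega) hz h5.symm h4 (by omega)
        rw [show ((n : ℤ) - ((k + 1 : ℕ) : ℤ)) = n - k - 1 by push_cast; ring, ← h7, hz', ihk]
    intro i
    rcases lt_trichotomy i (n + 1) with h | h | h
    · obtain ⟨k, rfl⟩ : ∃ k : ℕ, i = n - k := ⟨(n - i).toNat, by omega⟩
      rw [hle k]; omega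
    · subst h; rw [h1]; omega
    · exact hgt i h

theorem _root_.TwinTree.exists_line {x₀ x₁ : Vp} {y₀ y₁ : Vm} (hx : 𝒯.pos.Adj x₀ x₁)
    (hy : 𝒯.neg.Adj y₀ y₁) (h0 : 𝒯.codist x₀ y₀ = 0) (h1 : 𝒯.codist x₁ y₁ = 0) :
    ∃ p : ℤ → Vp, p 0 = x₀ ∧ p 1 = x₁ ∧ (∀ j, 𝒯.pos.Adj (p j) (p (j + 1))) ∧
      (∀ i, 𝒯.codist (p i) y₀ = (i - 0).natAbs) ∧ ∀ i, 𝒯.codist (p i) y₁ = (i - 1).natAbs := by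
  have h10 : 𝒯.codist x₁ y₀ = 1 := by have := 𝒯.codist_pos _ _ y₀ hx; omega
  have h01 : 𝒯.codist x₀ y₁ = 1 := by have := 𝒯.codist_neg x₀ _ _ hy; omega
  obtain ⟨f, f0, fadj, fc⟩ := exists_ray (𝒯 := 𝒯) x₁ y₀ (by omega)
  obtain ⟨g, g0, gadj, gc⟩ := exists_ray (𝒯 := 𝒯) x₀ y₁ (by omega)
  have fc' := codist_ray_neighbor f fadj hy (fun n => by rw [fc n]; omega) (by rw [f0, h1])
  have gc' := codist_ray_neighbor g gadj hy.symm (fun n => by rw [gc n]; omega) (by rw [g0, h0])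
  refine ⟨fun j => if 0 < j then f (j - 1).toNat else g (-j).toNat, by simpa using g0,
    by simpa using f0, fun j => ?_, fun i => ?_, fun i => ?_⟩
  · rcases lt_trichotomy j 0 with h | h | h
    · simp only [show ¬ 0 < j by omega, show ¬ 0 < j + 1 by omega, if_false]
      have := gadj (-(j + 1)).toNat
      rw [show (-(j + 1)).toNat + 1 = (-j).toNat by omega] at this
      exact this.symm
    · subst h; simpa [f0, g0] using hx
    · simp only [h, show 0 < j + 1 by omega, if_true]
      have := fadj (j - 1).toNat
      rwa [show (j - 1).toNat + 1 = (j + 1 - 1).toNat by omega] at this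
  · dsimp only
    split_ifs with h
    · rw [fc]; omega
    · rw [gc']; omega
  · dsimp only
    split_ifs with h
    · rw [fc']; omega
    · rw [gc]; omega

/-- Two opposite edges are contained in a twin apartment. -/
theorem exists_of_opposite_edges {x₀ x₁ : Vp} {y₀ y₁ : Vm} (hx : 𝒯.pos.Adj x₀ x₁)
    (hy : 𝒯.neg.Adj y₀ y₁) (h0 : 𝒯.codist x₀ y₀ = 0) (h1 : 𝒯.codist x₁ y₁ = 0) :
    ∃ F : 𝒯.Frame, F.p 0 = x₀ ∧ F.p 1 = x₁ ∧ F.m 0 = y₀ ∧ F.m 1 = y₁ := by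
  obtain ⟨p, p0, p1, padj, pc0, pc1⟩ := exists_line hx hy h0 h1
  obtain ⟨m, m0, m1, madj, mc0, mc1⟩ := exists_line (𝒯 := 𝒯.swap) hy hx h0 h1
  have mc0' : ∀ i, 𝒯.codist (p 0) (m i) = (0 - i).natAbs := fun i => by
    have := mc0 i; rw [p0]; simp only [TwinTree.swap] at this; omega
  have mc1' : ∀ i, 𝒯.codist (p 1) (m i) = (1 - i).natAbs := fun i => by
    have := mc1 i; rw [p1]; simp only [TwinTree.swap] at this; omega
  rw [← m0] at pc0
  rw [← m1] at pc1
  refine ⟨⟨p, m, padj, madj, fun i j => ?_⟩, p0, p1, m0, m1⟩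
  rcases le_or_gt 0 j with hj | hj
  · obtain ⟨n, rfl⟩ := Int.eq_ofNat_of_zero_le hj
    exact (codist_eq_of_nonneg padj madj pc0 pc1 mc0' n).1 i
  · -- the reflection `k ↦ 1 - k` reduces to nonnegative numbers
    have key := (codist_eq_of_nonneg (𝒯 := 𝒯) (p := fun k => p (1 - k)) (m := fun k => m (1 - k))
      (fun k => by
        have := (padj (1 - (k + 1))).symm; rwa [show 1 - (k + 1) + 1 = 1 - k by ring] at this)
      (fun k => by
        have := (madj (1 - (k + 1))).symm; rwa [show 1 - (k + 1) + 1 = 1 - k by ring] at this)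
      (fun i => by have := pc1 (1 - i); simp only [sub_zero] at *; rw [this]; omega)
      (fun i => by have := pc0 (1 - i); simp only [sub_self] at *; rw [this]; omega)
      (fun i => by have := mc1' (1 - i); simp only [sub_zero] at *; rw [this]; omega)
      (1 - j).toNat).1 (1 - i)
    rw [show 1 - (((1 - j).toNat : ℕ) : ℤ) = j by omega, show 1 - (1 - i) = i by ring] at key
    rw [key]; omega

end Frame

/-- The codistances along a line which has exactly one vertex opposite to `y`. -/
theorem codist_line {f : ℤ → Vp} (hadj : ∀ j, 𝒯.pos.Adj (f j) (f (j + 1)))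
    (hinj : Function.Injective f) {y : Vm} {j : ℤ} (hj : 𝒯.codist (f j) y = 0)
    (huniq : ∀ i, 𝒯.codist (f i) y = 0 → i = j) (i : ℤ) :
    𝒯.codist (f i) y = (i - j).natAbs := by
  rcases le_total j i with h | h
  · obtain ⟨n, rfl⟩ : ∃ n : ℕ, i = j + n := ⟨(i - j).toNat, by omega⟩
    rw [codist_ray (𝒯 := 𝒯) (fun n : ℕ => f (j + n)) y
      (fun n => by push_cast; rw [← add_assoc]; exact hadj _)
      (fun n h => by have := hinj h; omega) (by simpa using hj)
      (fun n h => by have := huniq _ h; omega) n]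
    omega
  · obtain ⟨n, rfl⟩ : ∃ n : ℕ, i = j - n := ⟨(j - i).toNat, by omega⟩
    rw [codist_ray (𝒯 := 𝒯) (fun n : ℕ => f (j - n)) y
      (fun n => by
        have := (hadj (j - (n + 1 : ℕ))).symm
        rwa [show j - ((n + 1 : ℕ) : ℤ) + 1 = j - n by push_cast; ring] at this)
      (fun n h => by have := hinj h; omega) (by simpa using hj)
      (fun n h => by have := huniq _ h; omega) n]
    omega

theorem TwinApartment.Numbering.codist_eq {L : 𝒯.TwinApartment} (N : L.Numbering) (i j : ℤ) :
    𝒯.codist (N.p i) (N.m j) = (i - j).natAbs := by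
  have hp : ∀ k, N.p k ∈ L.pos := fun k => N.range_p ▸ Set.mem_range_self k
  have hm : N.m j ∈ L.neg := N.range_m ▸ Set.mem_range_self j
  refine codist_line N.adj_p N.p_injective (N.opposite j) (fun k hk => N.p_injective ?_) i
  exact (L.unique_opposite_neg _ hm).unique ⟨hp k, hk⟩ ⟨hp j, N.opposite j⟩

/-- The frame of a numbering. -/
def TwinApartment.Numbering.toFrame {L : 𝒯.TwinApartment} (N : L.Numbering) : 𝒯.Frame :=
  ⟨N.p, N.m, N.adj_p, N.adj_m, N.codist_eq⟩

theorem _root_.isGeodesicLine_adj {V : Type u} {T : SimpleGraph V} {f : ℤ → V}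
    (hf : ∀ i j : ℤ, T.dist (f i) (f j) = (i - j).natAbs) {i j : ℤ} (h : (i - j).natAbs = 1) :
    T.Adj (f i) (f j) := by
  rw [← SimpleGraph.dist_eq_one_iff_adj, hf, h]

theorem _root_.isGeodesicLine_injective {V : Type u} {T : SimpleGraph V}
    {f : ℤ → V} (hf : ∀ i j : ℤ, T.dist (f i) (f j) = (i - j).natAbs) : Function.Injective f :=
  fun i j h => by
    have := hf i j
    rw [h, SimpleGraph.dist_self] at this
    omega

/-- Every twin apartment can be numbered: the vertices of the positive line are numbered in order,
and each vertex of the negative line gets the number of its opposite. -/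
theorem TwinApartment.exists_numbering (L : 𝒯.TwinApartment) : Nonempty L.Numbering := by
  obtain ⟨f, hf, hfL⟩ := L.isGeodesicLine_pos
  obtain ⟨g, hg, hgL⟩ := L.isGeodesicLine_neg
  have hfi := isGeodesicLine_injective hf
  have hgi := isGeodesicLine_injective hg
  have hfm : ∀ i, f i ∈ L.pos := fun i => hfL ▸ Set.mem_range_self i
  have hgm : ∀ i, g i ∈ L.neg := fun i => hgL ▸ Set.mem_range_self i
  have hσ : ∀ i, ∃ k, 𝒯.codist (f i) (g k) = 0 := fun i => by
    obtain ⟨y, ⟨hy, h⟩, -⟩ := L.unique_opposite_pos _ (hfm i)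
    rw [← hgL] at hy
    obtain ⟨k, rfl⟩ := hy
    exact ⟨k, h⟩
  choose σ hσ using hσ
  have hcod : ∀ i k, 𝒯.codist (f i) (g k) = (k - σ i).natAbs := fun i k =>
    codist_line (𝒯 := 𝒯.swap) (f := g) (fun j => isGeodesicLine_adj hg (by omega)) hgi
      (hσ i) (fun k' hk' => hgi ((L.unique_opposite_pos _ (hfm i)).unique ⟨hgm _, hk'⟩
        ⟨hgm _, hσ i⟩)) k
  have hfadj : ∀ j, 𝒯.pos.Adj (f j) (f (j + 1)) := fun j => isGeodesicLine_adj hf (by omega)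
  have hσi : Function.Injective σ := fun i j h => hfi <|
    (L.unique_opposite_neg _ (hgm (σ i))).unique ⟨hfm i, hσ i⟩ ⟨hfm j, h ▸ hσ j⟩
  refine ⟨⟨f, g ∘ σ, hfi, hgi.comp hσi, hfL, ?_, hfadj, fun j => ?_, hσ⟩⟩
  · apply Set.Subset.antisymm
    · rintro _ ⟨i, rfl⟩; exact hgm _
    · intro y hy
      obtain ⟨x, ⟨hx, h⟩, -⟩ := L.unique_opposite_neg y hy
      rw [← hfL] at hx
      obtain ⟨i, rfl⟩ := hx
      exact ⟨i, (L.unique_opposite_pos _ (hfm i)).unique ⟨hgm _, hσ i⟩ ⟨hy, h⟩⟩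
  · apply isGeodesicLine_adj hg
    have h1 := hcod j (σ (j + 1))
    have h2 := 𝒯.codist_pos _ _ (g (σ (j + 1))) (hfadj j)
    have h3 := hσ (j + 1)
    omega

namespace Frame

theorem dist_p (F : 𝒯.Frame) (i j : ℤ) : 𝒯.pos.dist (F.p i) (F.p j) = (i - j).natAbs := by
  have upper : ∀ (i : ℤ) (n : ℕ), ∃ w : 𝒯.pos.Walk (F.p i) (F.p (i + n)), w.length = n := by
    intro i n
    induction n with
    | zero => exact ⟨SimpleGraph.Walk.nil.copy rfl (by simp), by simp⟩
    | succ n ih =>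
      obtain ⟨w, hw⟩ := ih
      refine ⟨(w.concat (F.adj_p _)).copy rfl (by push_cast; rw [add_assoc]), by simp [hw]⟩
  have lower : ∀ (x : Vp) (i j : ℤ) (w : 𝒯.pos.Walk (F.p i) x),
      𝒯.codist (F.p i) (F.m j) ≤ 𝒯.codist x (F.m j) + w.length := by
    intro x i j w
    generalize F.p i = z at w
    induction w with
    | nil => simp
    | cons h w ih =>
      rw [SimpleGraph.Walk.length_cons]
      have := 𝒯.codist_pos _ _ (F.m j) h
      omega
  apply le_antisymm
  · rcases le_total i j with h | h
    · obtain ⟨w, hw⟩ := upper i (j - i).toNat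
      have := hw ▸ SimpleGraph.dist_le w
      rw [show i + ((j - i).toNat : ℤ) = j by omega] at this
      omega
    · obtain ⟨w, hw⟩ := upper j (i - j).toNat
      have := hw ▸ SimpleGraph.dist_le w
      rw [show j + ((i - j).toNat : ℤ) = i by omega, SimpleGraph.dist_comm] at this
      omega
  · obtain ⟨w, hw⟩ := (𝒯.isTree_pos.1 (F.p i) (F.p j)).exists_walk_length_eq_dist
    have h1 := lower _ i j w
    have h2 := F.codist_eq i j
    have h3 := F.codist_eq j j
    omega

/-- The twin apartment underlying a frame. -/
def apartment (F : 𝒯.Frame) : 𝒯.TwinApartment where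
  pos := Set.range F.p
  neg := Set.range F.m
  isGeodesicLine_pos := ⟨F.p, F.dist_p, rfl⟩
  isGeodesicLine_neg := ⟨F.m, F.swap.dist_p, rfl⟩
  unique_opposite_pos := by
    rintro _ ⟨i, rfl⟩
    refine ⟨F.m i, ⟨⟨i, rfl⟩, by rw [F.codist_eq]; omega⟩, ?_⟩
    rintro _ ⟨⟨j, rfl⟩, h⟩
    rw [F.codist_eq] at h
    congr 1; omega
  unique_opposite_neg := by
    rintro _ ⟨i, rfl⟩
    refine ⟨F.p i, ⟨⟨i, rfl⟩, by rw [F.codist_eq]; omega⟩, ?_⟩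
    rintro _ ⟨⟨j, rfl⟩, h⟩
    rw [F.codist_eq] at h
    congr 1; omega

/-- The numbering underlying a frame. -/
def numbering (F : 𝒯.Frame) : F.apartment.Numbering where
  p := F.p
  m := F.m
  p_injective := F.p_injective
  m_injective := F.m_injective
  range_p := rfl
  range_m := rfl
  adj_p := F.adj_p
  adj_m := F.adj_m
  opposite j := by rw [F.codist_eq]; omega

end Frame

end TwinTree

/-! ### Automorphisms and root groups -/

namespace TwinTree

variable {Vp : Type u} {Vm : Type v} {𝒯 : TwinTree Vp Vm}

theorem adj_smul_pos (g : 𝒯.Aut) {x x' : Vp} : 𝒯.pos.Adj (g • x) (g • x') ↔ 𝒯.pos.Adj x x' :=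
  (𝒯.toAutPos g).map_rel_iff

theorem adj_smul_neg (g : 𝒯.Aut) {y y' : Vm} : 𝒯.neg.Adj (g • y) (g • y') ↔ 𝒯.neg.Adj y y' :=
  (𝒯.toAutNeg g).map_rel_iff

theorem codist_smul (g : 𝒯.Aut) (x : Vp) (y : Vm) : 𝒯.codist (g • x) (g • y) = 𝒯.codist x y :=
  g.2 x y

theorem adj_inv_smul_pos (g : 𝒯.Aut) {x x' : Vp} :
    𝒯.pos.Adj x (g⁻¹ • x') ↔ 𝒯.pos.Adj (g • x) x' := by
  rw [← adj_smul_pos g, smul_inv_smul]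

theorem adj_inv_smul_neg (g : 𝒯.Aut) {y y' : Vm} :
    𝒯.neg.Adj y (g⁻¹ • y') ↔ 𝒯.neg.Adj (g • y) y' := by
  rw [← adj_smul_neg g, smul_inv_smul]

theorem adj_pos_of_fixed {g : 𝒯.Aut} {x x' : Vp} (hx : g • x = x) (h : 𝒯.pos.Adj x x') :
    𝒯.pos.Adj x (g • x') := by
  rw [← adj_smul_pos g, hx] at h; exact h

theorem adj_neg_of_fixed {g : 𝒯.Aut} {y y' : Vm} (hy : g • y = y) (h : 𝒯.neg.Adj y y') :
    𝒯.neg.Adj y (g • y') := by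
  rw [← adj_smul_neg g, hy] at h; exact h

theorem codist_of_fixed_neg {g : 𝒯.Aut} {y : Vm} (hy : g • y = y) (x : Vp) :
    𝒯.codist (g • x) y = 𝒯.codist x y := by
  conv_lhs => rw [← hy]
  exact codist_smul g x y

theorem codist_of_fixed_pos {g : 𝒯.Aut} {x : Vp} (hx : g • x = x) (y : Vm) :
    𝒯.codist x (g • y) = 𝒯.codist x y := by
  conv_lhs => rw [← hx]
  exact codist_smul g x y

namespace Frame

/-- The image of a frame under an automorphism. -/
def map (F : 𝒯.Frame) (g : 𝒯.Aut) : 𝒯.Frame where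
  p j := g • F.p j
  m j := g • F.m j
  adj_p j := (adj_smul_pos g).2 (F.adj_p j)
  adj_m j := (adj_smul_neg g).2 (F.adj_m j)
  codist_eq i j := by rw [codist_smul, F.codist_eq]

@[simp] theorem map_p (F : 𝒯.Frame) (g : 𝒯.Aut) (j : ℤ) : (F.map g).p j = g • F.p j := rfl
@[simp] theorem map_m (F : 𝒯.Frame) (g : 𝒯.Aut) (j : ℤ) : (F.map g).m j = g • F.m j := rfl

/-- An automorphism which fixes `p i` and `m j` for `j < i` fixes the ray starting at `p i`. -/
theorem smul_p_of_le (F : 𝒯.Frame) {g : 𝒯.Aut} {i j : ℤ} (hp : g • F.p i = F.p i)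
    (hm : g • F.m j = F.m j) (hij : j < i) {k : ℤ} (hk : i ≤ k) : g • F.p k = F.p k :=
  eq_p_of_le (F := F.map g) (F' := F) hp hm hij hk

theorem smul_m_of_ge (F : 𝒯.Frame) {g : 𝒯.Aut} {i j : ℤ} (hp : g • F.p i = F.p i)
    (hm : g • F.m j = F.m j) (hij : j < i) {k : ℤ} (hk : k ≤ j) : g • F.m k = F.m k :=
  eq_m_of_ge (F := F.map g) (F' := F) hp hm hij hk

/-- An automorphism which fixes two opposite edges of a frame fixes the frame. -/
theorem map_eq_self (F : 𝒯.Frame) {g : 𝒯.Aut} {j : ℤ} (h0 : g • F.p j = F.p j)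
    (h1 : g • F.p (j + 1) = F.p (j + 1)) (h2 : g • F.m j = F.m j)
    (h3 : g • F.m (j + 1) = F.m (j + 1)) : F.map g = F :=
  eq_of_opposite_edges (F := F.map g) (F' := F) h0 h1 h2 h3

/-- The root group of the twin root with boundary `{p j, m j}` containing `p k` for `k ≥ j`. -/
def rootGroup (F : 𝒯.Frame) (j : ℤ) : Subgroup 𝒯.Aut := F.numbering.rootGroup j

theorem mem_rootGroup {F : 𝒯.Frame} {j : ℤ} {g : 𝒯.Aut} : g ∈ F.rootGroup j ↔
    (∀ k, j ≤ k → g • F.p k = F.p k) ∧ (∀ k, k ≤ j → g • F.m k = F.m k) ∧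
    (∀ k, j < k → ∀ x, 𝒯.pos.Adj (F.p k) x → g • x = x) ∧
    (∀ k, k < j → ∀ y, 𝒯.neg.Adj (F.m k) y → g • y = y) := by
  constructor
  · rintro ⟨h1, h2, h3, h4⟩
    exact ⟨fun k hk => h1 _ ⟨k, hk, rfl⟩, fun k hk => h2 _ ⟨k, hk, rfl⟩, h3, h4⟩
  · rintro ⟨h1, h2, h3, h4⟩
    refine ⟨?_, ?_, h3, h4⟩
    · rintro _ ⟨k, hk, rfl⟩; exact h1 k hk
    · rintro _ ⟨k, hk, rfl⟩; exact h2 k hk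

theorem rootGroup_shift (F : 𝒯.Frame) (n j : ℤ) :
    (F.shift n).rootGroup j = F.rootGroup (j + n) := by
  ext g
  simp only [mem_rootGroup, shift_p, shift_m]
  constructor <;> rintro ⟨h1, h2, h3, h4⟩
  · refine ⟨fun k hk => ?_, fun k hk => ?_, fun k hk => ?_, fun k hk => ?_⟩
    · simpa using h1 (k - n) (by omega)
    · simpa using h2 (k - n) (by omega)
    · simpa using h3 (k - n) (by omega)
    · simpa using h4 (k - n) (by omega)
  · exact ⟨fun k hk => h1 _ (by omega), fun k hk => h2 _ (by omega), fun k hk => h3 _ (by omega),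
      fun k hk => h4 _ (by omega)⟩

theorem conj_mem_rootGroup {F : 𝒯.Frame} {j : ℤ} {u : 𝒯.Aut} (hu : u ∈ F.rootGroup j)
    (g : 𝒯.Aut) : g * u * g⁻¹ ∈ (F.map g).rootGroup j := by
  rw [mem_rootGroup] at hu ⊢
  obtain ⟨h1, h2, h3, h4⟩ := hu
  refine ⟨fun k hk => ?_, fun k hk => ?_, fun k hk x hx => ?_, fun k hk y hy => ?_⟩
  · simp [mul_smul, h1 k hk]
  · simp [mul_smul, h2 k hk]
  · rw [mul_smul, mul_smul, h3 k hk _ ((adj_inv_smul_pos g).2 hx), smul_inv_smul]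
  · rw [mul_smul, mul_smul, h4 k hk _ ((adj_inv_smul_neg g).2 hy), smul_inv_smul]

/-! ### Transitivity of the root groups -/

/-- The local form of the Moufang property, for the twin roots of a frame pointing in the positive
direction: `U_{α_j}` is transitive on the neighbours of `p j`, respectively `m j`, outside of
`α_j`. -/
def RootTransitive (F : 𝒯.Frame) : Prop :=
  ∀ j, (∀ x, 𝒯.pos.Adj (F.p j) x → x ≠ F.p (j + 1) → ∃ g ∈ F.rootGroup j, g • F.p (j - 1) = x) ∧
    ∀ y, 𝒯.neg.Adj (F.m j) y → y ≠ F.m (j - 1) → ∃ g ∈ F.rootGroup j, g • F.m (j + 1) = y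

/-- The local form of the Moufang property for all twin roots of a frame. -/
def Moufang (F : 𝒯.Frame) : Prop := F.RootTransitive ∧ F.reverse.RootTransitive

theorem RootTransitive.shift {F : 𝒯.Frame} (h : F.RootTransitive) (n : ℤ) :
    (F.shift n).RootTransitive := by
  intro j
  simp only [shift_p, shift_m, rootGroup_shift]
  rw [show j + 1 + n = j + n + 1 by ring, show j - 1 + n = j + n - 1 by ring]
  exact h (j + n)

theorem RootTransitive.map {F : 𝒯.Frame} (h : F.RootTransitive) (g : 𝒯.Aut) :
    (F.map g).RootTransitive := by
  intro j
  refine ⟨fun x hx hne => ?_, fun y hy hne => ?_⟩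
  · obtain ⟨u, hu, hux⟩ := (h j).1 (g⁻¹ • x) ((adj_inv_smul_pos g).2 hx)
      (fun h => hne (by rw [inv_smul_eq_iff] at h; exact h))
    exact ⟨_, conj_mem_rootGroup hu g, by simp [mul_smul, hux]⟩
  · obtain ⟨u, hu, huy⟩ := (h j).2 (g⁻¹ • y) ((adj_inv_smul_neg g).2 hy)
      (fun h => hne (by rw [inv_smul_eq_iff] at h; exact h))
    exact ⟨_, conj_mem_rootGroup hu g, by simp [mul_smul, huy]⟩

theorem reverse_shift (F : 𝒯.Frame) (n : ℤ) : (F.shift n).reverse = F.reverse.shift (-n) := by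
  ext j <;> simp [add_comm]

theorem Moufang.shift {F : 𝒯.Frame} (h : F.Moufang) (n : ℤ) : (F.shift n).Moufang :=
  ⟨h.1.shift n, by rw [reverse_shift]; exact h.2.shift (-n)⟩

theorem Moufang.reverse {F : 𝒯.Frame} (h : F.Moufang) : F.reverse.Moufang :=
  ⟨h.2, by rw [reverse_reverse]; exact h.1⟩

theorem Moufang.map {F : 𝒯.Frame} (h : F.Moufang) (g : 𝒯.Aut) : (F.map g).Moufang :=
  ⟨h.1.map g, h.2.map g⟩

theorem exists_frame_of_adj_p (F : 𝒯.Frame) (j : ℤ) {x : Vp} (hx : 𝒯.pos.Adj (F.p j) x)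
    (hne : x ≠ F.p (j + 1)) : ∃ F' : 𝒯.Frame, F'.p (j - 1) = x ∧ (∀ k, j ≤ k → F'.p k = F.p k) ∧
      ∀ k, k ≤ j → F'.m k = F.m k := by
  have hc : 𝒯.codist x (F.m (j - 1)) = 0 := by
    have h1 := F.codist_eq j (j - 1)
    have h2 := F.codist_eq (j + 1) (j - 1)
    have h3 := 𝒯.codist_pos _ _ (F.m (j - 1)) hx
    have h4 : 𝒯.codist x (F.m (j - 1)) ≠ 𝒯.codist (F.p j) (F.m (j - 1)) + 1 := fun h =>
      hne (eq_of_codist_pos_succ (by omega) hx (F.adj_p j) h (by omega))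
    omega
  obtain ⟨F', h0, h1, h2, h3⟩ := exists_of_opposite_edges hx.symm (F.adj_m_sub j).symm hc
    (by rw [F.codist_eq]; omega)
  have key : ∀ k, (F'.shift (-(j - 1))).p k = F'.p (k - j + 1) := fun k => by
    simp only [shift_p]; congr 1; ring
  have keym : ∀ k, (F'.shift (-(j - 1))).m k = F'.m (k - j + 1) := fun k => by
    simp only [shift_m]; congr 1; ring
  have e0 : (F'.shift (-(j - 1))).p (j - 1) = x := by rw [key, ← h0]; congr 1; ring
  have e1 : (F'.shift (-(j - 1))).p j = F.p j := by rw [key, ← h1]; congr 1; ring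
  have e2 : (F'.shift (-(j - 1))).m (j - 1) = F.m (j - 1) := by rw [keym, ← h2]; congr 1; ring
  have e3 : (F'.shift (-(j - 1))).m j = F.m j := by rw [keym, ← h3]; congr 1; ring
  refine ⟨F'.shift (-(j - 1)), e0, fun k hk => eq_p_of_le e1 e2 (by omega) hk, fun k hk => ?_⟩
  rcases hk.lt_or_eq with hk | rfl
  · exact eq_m_of_ge e1 e2 (by omega) (by omega)
  · exact e3

theorem exists_frame_of_adj_m (F : 𝒯.Frame) (j : ℤ) {y : Vm} (hy : 𝒯.neg.Adj (F.m j) y)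
    (hne : y ≠ F.m (j - 1)) : ∃ F' : 𝒯.Frame, F'.m (j + 1) = y ∧ (∀ k, j ≤ k → F'.p k = F.p k) ∧
      ∀ k, k ≤ j → F'.m k = F.m k := by
  obtain ⟨F', h0, h1, h2⟩ := F.swap.reverse.exists_frame_of_adj_p (-j) (x := y)
    (by simpa [swap, TwinTree.swap] using hy)
    (by simpa [swap, show -(-j + 1) = j - 1 by ring] using hne)
  refine ⟨F'.reverse.swap, ?_, fun k hk => ?_, fun k hk => ?_⟩
  · simpa [swap, show -(j + 1) = -j - 1 by ring] using h0
  · simpa [swap] using h2 (-k) (by omega)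
  · simpa [swap] using h1 (-k) (by omega)

theorem rootTransitive_of_isRootGroup {F : 𝒯.Frame} (h : ∀ j, F.numbering.IsRootGroup j) :
    F.RootTransitive := by
  -- an element of the root group that maps the line of `F` to the line of `F'` maps the first
  -- vertex outside of the root to the first vertex outside of the root
  have key : ∀ (F' : 𝒯.Frame) (j : ℤ), (∀ k, j ≤ k → F'.p k = F.p k) →
      (∀ k, k ≤ j → F'.m k = F.m k) →
      ∃ g ∈ F.rootGroup j, g • F.p (j - 1) = F'.p (j - 1) ∧ g • F.m (j + 1) = F'.m (j + 1) := by
    intro F' j hp hm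
    obtain ⟨g, hg, hg1, hg2⟩ := h j F.apartment F'.apartment
      (by rintro _ ⟨k, -, rfl⟩; exact ⟨k, rfl⟩) (by rintro _ ⟨k, -, rfl⟩; exact ⟨k, rfl⟩)
      (by rintro _ ⟨k, hk, rfl⟩; exact ⟨k, hp k hk⟩) (by rintro _ ⟨k, hk, rfl⟩; exact ⟨k, hm k hk⟩)
    have hg' := mem_rootGroup.1 hg
    refine ⟨g, hg, ?_, ?_⟩
    · have : g • F.p (j - 1) ∈ F'.apartment.pos := by
        rw [← hg1]; exact Set.smul_mem_smul_set ⟨_, rfl⟩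
      obtain ⟨k, hk⟩ := this
      have h1 : 𝒯.pos.Adj (F'.p j) (F'.p k) := by
        rw [hk, hp j le_rfl]
        exact adj_pos_of_fixed (hg'.1 j le_rfl) (F.adj_p_sub j)
      rcases F'.adj_p_iff h1 with rfl | rfl
      · rw [hp _ (by omega), ← hg'.1 (j + 1) (by omega)] at hk
        have := F.p_injective (smul_left_cancel g hk)
        omega
      · exact hk.symm
    · have : g • F.m (j + 1) ∈ F'.apartment.neg := by
        rw [← hg2]; exact Set.smul_mem_smul_set ⟨_, rfl⟩
      obtain ⟨k, hk⟩ := this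
      have h1 : 𝒯.neg.Adj (F'.m j) (F'.m k) := by
        rw [hk, hm j le_rfl]
        exact adj_neg_of_fixed (hg'.2.1 j le_rfl) (F.adj_m j)
      rcases F'.adj_m_iff h1 with rfl | rfl
      · exact hk.symm
      · rw [hm _ (by omega), ← hg'.2.1 (j - 1) (by omega)] at hk
        have := F.m_injective (smul_left_cancel g hk)
        omega
  intro j
  refine ⟨fun x hx hne => ?_, fun y hy hne => ?_⟩
  · obtain ⟨F', h0, h1, h2⟩ := F.exists_frame_of_adj_p j hx hne
    obtain ⟨g, hg, hgx, -⟩ := key F' j h1 h2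
    exact ⟨g, hg, hgx.trans h0⟩
  · obtain ⟨F', h0, h1, h2⟩ := F.exists_frame_of_adj_m j hy hne
    obtain ⟨g, hg, -, hgy⟩ := key F' j h1 h2
    exact ⟨g, hg, hgy.trans h0⟩

theorem _root_.TwinTree.IsMoufang.exists_frame (h : 𝒯.IsMoufang) : ∃ F : 𝒯.Frame, F.Moufang := by
  obtain ⟨L, hL⟩ := h
  obtain ⟨N⟩ := L.exists_numbering
  have key : ∀ N : L.Numbering, N.toFrame.RootTransitive := fun N =>
    rootTransitive_of_isRootGroup fun j L₁ L₂ => hL N j L₁ L₂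
  exact ⟨N.toFrame, key N, key N.reverse⟩

theorem _root_.SimpleGraph.Preconnected.induction_adj {V : Type u} {T : SimpleGraph V}
    (hT : T.Preconnected) {P : V → Prop} {x : V} (hx : P x) (hP : ∀ y z, T.Adj y z → P y → P z)
    (y : V) : P y := by
  obtain ⟨w⟩ := hT x y
  induction w with
  | nil => exact hx
  | cons h w ih => exact ih (hP _ _ h hx)

/-- A Moufang frame can be moved to any vertex of the positive tree, by elements of root groups
and shifts. -/
theorem Moufang.exists_p_zero {F : 𝒯.Frame} (h : F.Moufang) (x : Vp) :
    ∃ F' : 𝒯.Frame, F'.Moufang ∧ F'.p 0 = x := by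
  refine 𝒯.isTree_pos.1.preconnected.induction_adj
    (P := fun x => ∃ F' : 𝒯.Frame, F'.Moufang ∧ F'.p 0 = x) (x := F.p 0) ⟨F, h, rfl⟩ ?_ x
  rintro y z hyz ⟨F, hF, rfl⟩
  by_cases hz : z = F.p (0 + 1)
  · exact ⟨F.shift 1, hF.shift 1, hz.symm⟩
  · obtain ⟨u, -, hu⟩ := (hF.1 0).1 z hyz hz
    exact ⟨(F.map u).shift (-1), (hF.map u).shift (-1), hu⟩

theorem Moufang.exists_edge {F : 𝒯.Frame} (h : F.Moufang) {x x' : Vp} (hx : 𝒯.pos.Adj x x') :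
    ∃ F' : 𝒯.Frame, F'.Moufang ∧ F'.p 0 = x ∧ F'.p 1 = x' := by
  obtain ⟨F, hF, rfl⟩ := h.exists_p_zero x
  by_cases hx' : x' = F.p 1
  · exact ⟨F, hF, rfl, hx'.symm⟩
  · obtain ⟨u, hu, hux⟩ := (hF.1 0).1 x' hx hx'
    exact ⟨(F.map u).reverse, (hF.map u).reverse, (mem_rootGroup.1 hu).1 0 le_rfl, hux⟩

/-- A Moufang frame containing a given edge of the positive tree can be moved, keeping that edge,
to any vertex of the negative tree. -/
theorem Moufang.exists_edge_m {F : 𝒯.Frame} (h : F.Moufang) {x x' : Vp} (hx : 𝒯.pos.Adj x x')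
    (y : Vm) : ∃ F' : 𝒯.Frame, F'.Moufang ∧ F'.p 0 = x ∧ F'.p 1 = x' ∧ ∃ k, F'.m k = y := by
  obtain ⟨F, hF, h0, h1⟩ := h.exists_edge hx
  refine 𝒯.isTree_neg.1.preconnected.induction_adj (P := fun y => ∃ F' : 𝒯.Frame, F'.Moufang ∧
    F'.p 0 = x ∧ F'.p 1 = x' ∧ ∃ k, F'.m k = y) (x := F.m 0) ⟨F, hF, h0, h1, 0, rfl⟩ ?_ y
  rintro y z hyz ⟨F, hF, h0, h1, k, rfl⟩
  by_cases hz : z = F.m (k + 1)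
  · exact ⟨F, hF, h0, h1, k + 1, hz.symm⟩
  by_cases hz' : z = F.m (k - 1)
  · exact ⟨F, hF, h0, h1, k - 1, hz'.symm⟩
  rcases le_or_gt k 0 with hk | hk
  · obtain ⟨u, hu, huz⟩ := (hF.1 k).2 z hyz hz'
    have hu := mem_rootGroup.1 hu
    exact ⟨F.map u, hF.map u, (hu.1 0 hk).trans h0, (hu.1 1 (by omega)).trans h1, k + 1, huz⟩
  · obtain ⟨u, hu, huz⟩ := (hF.2 (-k)).2 z (by simpa using hyz)
      (by simpa [show -(-k - 1) = k + 1 by ring] using hz)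
    have hu := mem_rootGroup.1 hu
    have h1' : u • F.p 1 = F.p 1 := by simpa using hu.1 (-1) (by omega)
    refine ⟨F.map u, hF.map u, (hu.1 0 (by omega)).trans h0, h1'.trans h1, k - 1, ?_⟩
    simpa [show -(-k + 1) = k - 1 by ring] using huz

/-- If one frame is Moufang, then all frames are, because the root groups are transitive on pairs
of opposite edges up to shifts and reversal. -/
theorem Moufang.of_frame {F : 𝒯.Frame} (h : F.Moufang) (F' : 𝒯.Frame) : F'.Moufang := by
  obtain ⟨G, hG, h0, h1, k, hk⟩ := h.exists_edge_m (F'.adj_p 0) (F'.m 0)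
  have hk0 : k = 0 := by
    have h2 := G.codist_eq 0 k
    rw [h0, hk, F'.codist_eq] at h2
    omega
  subst hk0
  have hne : F'.m 1 ≠ G.m (0 - 1) := by
    intro he
    have h2 := G.codist_eq 1 (0 - 1)
    have h3 := F'.codist_eq (0 + 1) 1
    rw [← he, h1, h3] at h2
    omega
  obtain ⟨u, hu, hum⟩ := (hG.1 0).2 (F'.m 1) (hk ▸ F'.adj_m 0) hne
  have hu := mem_rootGroup.1 hu
  have : G.map u = F' := eq_of_opposite_edges (j := 0) ((hu.1 0 le_rfl).trans h0)
    ((hu.1 1 (by omega)).trans h1) ((hu.2.1 0 le_rfl).trans hk) hum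
  exact this ▸ hG.map u

theorem _root_.TwinTree.IsMoufang.moufang (h : 𝒯.IsMoufang) (F : 𝒯.Frame) : F.Moufang :=
  h.exists_frame.elim fun _ hF => hF.of_frame F

end Frame

/-! ### Rigidity -/

/-- The neighbours of two opposite vertices correspond to each other, a neighbour `x'` of `x` being
matched with the neighbour of `y` at codistance two from `x'`. -/
theorem fixes_neighbors_neg {g : 𝒯.Aut} {x : Vp} {y : Vm} (hxy : 𝒯.codist x y = 0)
    (hy : g • y = y) (hx : ∀ x', 𝒯.pos.Adj x x' → g • x' = x') {y' : Vm} (h : 𝒯.neg.Adj y y') :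
    g • y' = y' := by
  have h1 : 𝒯.codist x y' = 1 := by have := 𝒯.codist_neg x _ _ h; omega
  obtain ⟨x', ⟨hx', hc⟩, -⟩ := 𝒯.codist_pos_unique x y' (by omega)
  have h2 : 𝒯.codist x' y = 1 := by have := 𝒯.codist_pos _ _ y hx'; omega
  have h3 := codist_of_fixed_pos (hx x' hx') y'
  exact eq_of_codist_neg_succ (x := x') (y := y) (by omega) (adj_neg_of_fixed hy h) h
    (by omega) (by omega)

theorem fixes_neighbors_pos {g : 𝒯.Aut} {x : Vp} {y : Vm} (hxy : 𝒯.codist x y = 0)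
    (hx : g • x = x) (hy : ∀ y', 𝒯.neg.Adj y y' → g • y' = y') {x' : Vp} (h : 𝒯.pos.Adj x x') :
    g • x' = x' := by
  have h1 : 𝒯.codist x' y = 1 := by have := 𝒯.codist_pos _ _ y h; omega
  obtain ⟨y', ⟨hy', hc⟩, -⟩ := 𝒯.codist_neg_unique x' y (by omega)
  have h2 : 𝒯.codist x y' = 1 := by have := 𝒯.codist_neg x _ _ hy'; omega
  have h3 := codist_of_fixed_neg (hy y' hy') x'
  exact eq_of_codist_pos_succ (x := x) (y := y') (by omega) (adj_pos_of_fixed hx h) h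
    (by omega) (by omega)

theorem exists_third {V : Type u} {s : Set V} (h : 3 ≤ s.encard) (a b : V) :
    ∃ c ∈ s, c ≠ a ∧ c ≠ b := by
  by_contra! hc
  have h1 : s ⊆ {a, b} := fun c hcs => by
    by_cases ha : c = a
    · exact Or.inl ha
    · exact Or.inr (hc c hcs ha)
  have h2 := (h.trans (Set.encard_le_encard h1)).trans (Set.encard_insert_le {b} a)
  rw [Set.encard_singleton] at h2
  exact absurd h2 (by decide)

theorem IsThick.exists_adj_pos (h : 𝒯.IsThick) (x a b : Vp) :
    ∃ c, 𝒯.pos.Adj x c ∧ c ≠ a ∧ c ≠ b := exists_third (h.1 x) a b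

/-- Two vertices at codistance one from `y` are both opposite to some neighbour of `y`, because each
of them is opposite to all neighbours but one. -/
theorem IsThick.exists_opposite (h : 𝒯.IsThick) {x₀ x₂ : Vp} {y : Vm} (h0 : 𝒯.codist x₀ y = 1)
    (h2 : 𝒯.codist x₂ y = 1) :
    ∃ z, 𝒯.neg.Adj y z ∧ 𝒯.codist x₀ z = 0 ∧ 𝒯.codist x₂ z = 0 := by
  obtain ⟨a, ⟨ha, ha'⟩, -⟩ := 𝒯.codist_neg_unique x₀ y (by omega)
  obtain ⟨b, ⟨hb, hb'⟩, -⟩ := 𝒯.codist_neg_unique x₂ y (by omega)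
  obtain ⟨z, hz, hza, hzb⟩ := exists_third (h.2 y) a b
  have h3 : 𝒯.codist x₀ z ≠ 𝒯.codist x₀ y + 1 := fun h =>
    hza (eq_of_codist_neg_succ (by omega) hz ha h ha')
  have h4 : 𝒯.codist x₂ z ≠ 𝒯.codist x₂ y + 1 := fun h =>
    hzb (eq_of_codist_neg_succ (by omega) hz hb h hb')
  have h5 := 𝒯.codist_neg x₀ _ _ hz
  have h6 := 𝒯.codist_neg x₂ _ _ hz
  exact ⟨z, hz, by omega, by omega⟩

/-- Rigidity of thick twin trees: an automorphism is trivial if it fixes two opposite edges and all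
neighbours of the vertices of one of them. The property propagates to the neighbouring edges: if
`x₂` is a neighbour of `x₁`, then by thickness `y₁` has a neighbour `y` opposite to both `x₀` and
`x₂`, so that the neighbours of `y`, hence those of `x₂`, are fixed. -/
theorem IsThick.eq_one_of_fixes (hth : 𝒯.IsThick) {g : 𝒯.Aut} {x₀ x₁ : Vp} {y₀ y₁ : Vm}
    (hx : 𝒯.pos.Adj x₀ x₁) (hy : 𝒯.neg.Adj y₀ y₁) (h0 : 𝒯.codist x₀ y₀ = 0)
    (h1 : 𝒯.codist x₁ y₁ = 0) (hx0 : ∀ x, 𝒯.pos.Adj x₀ x → g • x = x)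
    (hx1 : ∀ x, 𝒯.pos.Adj x₁ x → g • x = x) (hy0 : g • y₀ = y₀) (hy1 : g • y₁ = y₁) : g = 1 := by
  have key : ∀ x : Vp, ∃ (x₀ : Vp) (y₀ y : Vm), 𝒯.pos.Adj x₀ x ∧ 𝒯.neg.Adj y₀ y ∧
      𝒯.codist x₀ y₀ = 0 ∧ 𝒯.codist x y = 0 ∧ (∀ z, 𝒯.pos.Adj x₀ z → g • z = z) ∧
      (∀ z, 𝒯.pos.Adj x z → g • z = z) ∧ g • y₀ = y₀ ∧ g • y = y := by
    refine 𝒯.isTree_pos.1.preconnected.induction_adj (x := x₁)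
      ⟨x₀, y₀, y₁, hx, hy, h0, h1, hx0, hx1, hy0, hy1⟩ ?_
    rintro x₁ x₂ h12 ⟨x₀, y₀, y₁, hx, hy, h0, h1, hx0, hx1, hy0, hy1⟩
    have hx01 : 𝒯.codist x₀ y₁ = 1 := by have := 𝒯.codist_neg x₀ _ _ hy; omega
    have hx21 : 𝒯.codist x₂ y₁ = 1 := by have := 𝒯.codist_pos _ _ y₁ h12; omega
    obtain ⟨y, hyy, hy0', hy2⟩ := hth.exists_opposite hx01 hx21
    have hgy : g • y = y := fixes_neighbors_neg h1 hy1 hx1 hyy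
    have hyz : ∀ z, 𝒯.neg.Adj y z → g • z = z := fun z hz =>
      fixes_neighbors_neg hy0' hgy hx0 hz
    exact ⟨x₁, y₁, y, h12, hyy, h1, hy2, hx1,
      fun z hz => fixes_neighbors_pos hy2 (hx1 _ h12) hyz hz, hy1, hgy⟩
  have hpos : ∀ x : Vp, g • x = x := fun x => by
    obtain ⟨x₀, _, _, hx, -, -, -, h, -⟩ := key x
    exact h x hx
  have hneg : ∀ y : Vm, g • y = y ∧ ∃ x, 𝒯.codist x y = 0 := by
    refine 𝒯.isTree_neg.1.preconnected.induction_adj (x := y₀) ⟨hy0, x₀, h0⟩ ?_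
    rintro y z hyz ⟨hy, x, hxy⟩
    refine ⟨fixes_neighbors_neg hxy hy (fun x' _ => hpos x') hyz, ?_⟩
    have h1 : 𝒯.codist x z = 1 := by have := 𝒯.codist_neg x _ _ hyz; omega
    obtain ⟨a, ⟨ha, ha'⟩, -⟩ := 𝒯.codist_pos_unique x z (by omega)
    obtain ⟨c, hc, hca, -⟩ := hth.exists_adj_pos x a a
    have h2 := 𝒯.codist_pos _ _ z hc
    have h3 : 𝒯.codist c z ≠ 𝒯.codist x z + 1 := fun h =>
      hca (eq_of_codist_pos_succ (by omega) hc ha h ha')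
    exact ⟨c, by omega⟩
  apply Subtype.ext
  apply Prod.ext
  · exact RelIso.ext hpos
  · exact RelIso.ext fun y => (hneg y).1

end TwinTree

/-! ### The stabilizer of a vertex of the negative tree -/

/-- In a connected locally finite graph, the balls are finite. -/
theorem SimpleGraph.Connected.finite_ball {V : Type u} {T : SimpleGraph V} (hT : T.Connected)
    (hf : ∀ x, (T.neighborSet x).Finite) (x : V) (n : ℕ) : {y | T.dist x y ≤ n}.Finite := by
  induction n with
  | zero =>
    refine (Set.finite_singleton x).subset fun y hy => ?_
    exact ((hT.dist_eq_zero_iff).1 (Nat.le_zero.1 hy)).symm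
  | succ n ih =>
    refine (ih.union (ih.biUnion fun y _ => hf y)).subset fun y hy => ?_
    rcases Nat.lt_or_ge n (T.dist x y) with h | h
    · right
      obtain ⟨w, hw⟩ := (hT x y).exists_walk_length_eq_dist
      have hn : ¬ w.Nil := fun hn => by
        have := SimpleGraph.Walk.length_eq_zero_iff.2 hn
        omega
      have hpen := w.adj_penultimate hn
      refine Set.mem_iUnion₂.2 ⟨w.penultimate, ?_, hpen⟩
      have h1 := SimpleGraph.dist_le w.dropLast
      have h2 := SimpleGraph.Walk.length_dropLast_add_one hn
      have h3 : T.dist x y ≤ n + 1 := hy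
      exact h1.trans (by omega)
    · exact Or.inl h

theorem SimpleGraph.Iso.dist_map {V : Type u} {T : SimpleGraph V} (hT : T.Connected) (g : T ≃g T)
    (x y : V) : T.dist (g x) (g y) = T.dist x y := by
  have key : ∀ (g : T ≃g T) (x y : V), T.dist (g x) (g y) ≤ T.dist x y := fun g x y => by
    obtain ⟨w, hw⟩ := (hT x y).exists_walk_length_eq_dist
    have := SimpleGraph.dist_le (w.map g.toHom)
    rw [SimpleGraph.Walk.length_map, hw] at this
    exact this
  refine le_antisymm (key g x y) ?_
  have := key g.symm (g x) (g y)
  rwa [g.symm_apply_apply, g.symm_apply_apply] at this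

namespace TwinTree

variable {Vp : Type u} {Vm : Type v} {𝒯 : TwinTree Vp Vm}

theorem dist_smul (g : 𝒯.Aut) (x y : Vp) : 𝒯.pos.dist (g • x) (g • y) = 𝒯.pos.dist x y :=
  SimpleGraph.Iso.dist_map 𝒯.isTree_pos.1 _ x y

namespace Frame

/-- `Γ` fixes the vertex `m 0` of the frame, and contains the root groups of all twin roots of the
frame that contain `m 0`. -/
structure IsVertexGroup (F : 𝒯.Frame) (Γ : Subgroup 𝒯.Aut) : Prop where
  fixes : ∀ g ∈ Γ, g • F.m 0 = F.m 0
  rootGroup_le : ∀ j, 0 ≤ j → F.rootGroup j ≤ Γ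
  rootGroup_reverse_le : ∀ j, 0 ≤ j → F.reverse.rootGroup j ≤ Γ

variable {F : 𝒯.Frame} {Γ : Subgroup 𝒯.Aut}

theorem IsVertexGroup.reverse (h : F.IsVertexGroup Γ) : F.reverse.IsVertexGroup Γ :=
  ⟨by simpa using h.fixes, h.rootGroup_reverse_le, by simpa using h.rootGroup_le⟩

theorem codist_p_zero (F : 𝒯.Frame) (n : ℕ) : 𝒯.codist (F.p n) (F.m 0) = n := by
  rw [F.codist_eq]; omega

theorem IsVertexGroup.codist_smul (h : F.IsVertexGroup Γ) {g : 𝒯.Aut} (hg : g ∈ Γ) (x : Vp) :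
    𝒯.codist (g • x) (F.m 0) = 𝒯.codist x (F.m 0) :=
  codist_of_fixed_neg (h.fixes g hg) x

/-- By thickness, the root groups of the two twin roots with boundary `{p 0, m 0}` generate a group
that is transitive on the neighbours of `p 0`. -/
theorem Moufang.exists_smul_p_one (hM : F.Moufang) (hth : 𝒯.IsThick) {x : Vp}
    (hx : 𝒯.pos.Adj (F.p 0) x) :
    ∃ g ∈ F.rootGroup 0 ⊔ F.reverse.rootGroup 0, g • F.p 1 = x := by
  have key : ∀ z, 𝒯.pos.Adj (F.p 0) z → z ≠ F.p (-1) →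
      ∃ g ∈ F.rootGroup 0 ⊔ F.reverse.rootGroup 0, g • F.p 1 = z := by
    intro z hz hne
    obtain ⟨g, hg, hgx⟩ := (hM.2 0).1 z (by simpa using hz) (by simpa using hne)
    exact ⟨g, Subgroup.mem_sup_right hg, by simpa using hgx⟩
  by_cases h : x = F.p (-1)
  · obtain ⟨z, hz, hz1, hz2⟩ := hth.exists_adj_pos (F.p 0) (F.p 1) (F.p (-1))
    obtain ⟨g, hg, hgz⟩ := key z hz hz2
    obtain ⟨k, hk, hkz⟩ := (hM.1 0).1 z hz hz1
    obtain ⟨k', hk', hkx⟩ := (hM.1 0).1 x hx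
      (fun h' => by rw [h] at h'; exact absurd (F.p_injective h') (by norm_num))
    refine ⟨k' * k⁻¹ * g, Subgroup.mul_mem _ (Subgroup.mem_sup_left
      (Subgroup.mul_mem _ hk' (Subgroup.inv_mem _ hk))) hg, ?_⟩
    rw [mul_smul, mul_smul, hgz, ← hkz, inv_smul_smul, hkx]
  · exact key x hx h

theorem ne_of_codist {n : ℕ} {x : Vp} (hx : 𝒯.codist x (F.m 0) = n) : x ≠ F.p (n + 1 + 1) := by
  rintro rfl
  have := F.codist_p_zero (n + 1 + 1)
  push_cast at this
  omega

/-- The orbits of `Γ` on the positive tree are the level sets of the codistance from `m 0`. -/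
theorem IsVertexGroup.exists_smul_p (h : F.IsVertexGroup Γ) (hM : F.Moufang) (hth : 𝒯.IsThick)
    (x : Vp) : ∃ g ∈ Γ, g • F.p (𝒯.codist x (F.m 0)) = x := by
  refine 𝒯.isTree_pos.1.preconnected.induction_adj
    (P := fun x => ∃ g ∈ Γ, g • F.p (𝒯.codist x (F.m 0)) = x) (x := F.p 0)
    ⟨1, Γ.one_mem, by rw [F.codist_eq]; simp⟩ ?_ x
  rintro y z hyz ⟨g, hg, hgy⟩
  generalize hn : 𝒯.codist y (F.m 0) = n at hgy
  have hz : 𝒯.codist (g⁻¹ • z) (F.m 0) = 𝒯.codist z (F.m 0) := h.codist_smul (Γ.inv_mem hg) z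
  have hadj : 𝒯.pos.Adj (F.p n) (g⁻¹ • z) := (adj_inv_smul_pos g).2 (hgy ▸ hyz)
  suffices ∃ k ∈ Γ, k • F.p (𝒯.codist z (F.m 0)) = g⁻¹ • z by
    obtain ⟨k, hk, hkz⟩ := this
    exact ⟨g * k, Γ.mul_mem hg hk, by rw [mul_smul, hkz, smul_inv_smul]⟩
  rw [← hz]
  generalize g⁻¹ • z = z' at hadj
  rcases n with _ | n
  · obtain ⟨k, hk, hkz⟩ := hM.exists_smul_p_one hth (by simpa using hadj)
    have h1 := 𝒯.codist_pos _ _ (F.m 0) hadj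
    rw [F.codist_p_zero] at h1
    have h2 : 𝒯.codist z' (F.m 0) = 1 := by omega
    refine ⟨k, (sup_le (h.rootGroup_le 0 le_rfl) (h.rootGroup_reverse_le 0 le_rfl)) hk, ?_⟩
    rw [h2]; exact hkz
  · push_cast at hadj
    by_cases hne : z' = F.p (n + 1 + 1)
    · refine ⟨1, Γ.one_mem, ?_⟩
      have := F.codist_p_zero (n + 1 + 1)
      push_cast at this
      rw [one_smul, hne, this]
      push_cast; rfl
    · obtain ⟨k, hk, hkz⟩ := (hM.1 (n + 1)).1 z' hadj hne
      have hkΓ := h.rootGroup_le (n + 1) (by omega) hk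
      refine ⟨k, hkΓ, ?_⟩
      rw [← hkz, h.codist_smul hkΓ, show (n : ℤ) + 1 - 1 = n by ring, F.codist_p_zero]

theorem IsVertexGroup.exists_smul_edge (h : F.IsVertexGroup Γ) (hM : F.Moufang)
    (hth : 𝒯.IsThick) {x y : Vp} (hxy : 𝒯.pos.Adj x y) {n : ℕ} (hx : 𝒯.codist x (F.m 0) = n)
    (hy : 𝒯.codist y (F.m 0) = n + 1) : ∃ g ∈ Γ, g • F.p n = x ∧ g • F.p (n + 1) = y := by
  obtain ⟨g, hg, hgy⟩ := h.exists_smul_p hM hth y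
  rw [hy] at hgy
  push_cast at hgy
  have hgx : 𝒯.codist (g⁻¹ • x) (F.m 0) = n := (h.codist_smul (Γ.inv_mem hg) x).trans hx
  obtain ⟨k, hk, hkx⟩ := (hM.1 (n + 1)).1 (g⁻¹ • x)
    ((adj_inv_smul_pos g).2 (by rw [hgy]; exact hxy.symm)) (ne_of_codist hgx)
  rw [add_sub_cancel_right] at hkx
  refine ⟨g * k, Γ.mul_mem hg (h.rootGroup_le _ (by omega) hk), ?_, ?_⟩
  · rw [mul_smul, hkx, smul_inv_smul]
  · rw [mul_smul, (mem_rootGroup.1 hk).1 _ le_rfl, hgy]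

/-- The vertex and the edge of the ray in the orbit of a given vertex or edge are read off from the
codistances from `m 0`. -/
theorem IsVertexGroup.isTreeFundamentalDomain (h : F.IsVertexGroup Γ) (hM : F.Moufang)
    (hth : 𝒯.IsThick) :
    IsTreeFundamentalDomain (𝒯.toAutPos.comp Γ.subtype) (𝒯.posSpan (F.p '' Set.Ici 0)) := by
  have hp : ∀ s ∈ F.p '' Set.Ici 0, F.p (𝒯.codist s (F.m 0)) = s := by
    rintro _ ⟨k, hk, rfl⟩
    obtain ⟨n, rfl⟩ := Int.eq_ofNat_of_zero_le hk
    rw [F.codist_p_zero]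
  constructor
  · intro x
    obtain ⟨g, hg, hgx⟩ := h.exists_smul_p hM hth x
    refine ⟨_, ⟨⟨_, Int.natCast_nonneg _, rfl⟩, ⟨g, hg⟩, hgx⟩, ?_⟩
    rintro s ⟨hs, γ, rfl⟩
    have h1 : 𝒯.codist ((𝒯.toAutPos.comp Γ.subtype) γ s) (F.m 0) = 𝒯.codist s (F.m 0) :=
      h.codist_smul γ.2 s
    rw [h1, hp s hs]
  · have uniq : ∀ f ∈ (𝒯.posSpan (F.p '' Set.Ici 0)).edgeSet, ∀ γ : Γ,
        f = ((f.map ((𝒯.toAutPos.comp Γ.subtype) γ)).map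
          (fun x => 𝒯.codist x (F.m 0))).map fun n : ℕ => F.p n := by
      intro f hf γ
      induction f with | _ a b =>
      obtain ⟨ha, hb, -⟩ := hf
      have h1 : ∀ s, 𝒯.codist ((𝒯.toAutPos.comp Γ.subtype) γ s) (F.m 0) = 𝒯.codist s (F.m 0) :=
        fun s => h.codist_smul γ.2 s
      simp only [Sym2.map_mk, h1, hp a ha, hp b hb]
    have ex : ∀ (x y : Vp), 𝒯.pos.Adj x y →
        𝒯.codist y (F.m 0) = 𝒯.codist x (F.m 0) + 1 →
        ∃ f : Sym2 Vp, f ∈ (𝒯.posSpan (F.p '' Set.Ici 0)).edgeSet ∧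
          ∃ γ : Γ, f.map ((𝒯.toAutPos.comp Γ.subtype) γ) = s(x, y) := by
      intro x y hxy hc
      obtain ⟨g, hg, hgx, hgy⟩ := h.exists_smul_edge hM hth hxy rfl hc
      refine ⟨s(F.p (𝒯.codist x (F.m 0)), F.p (𝒯.codist x (F.m 0) + 1)), ?_, ⟨g, hg⟩, ?_⟩
      · exact ⟨⟨_, Int.natCast_nonneg _, rfl⟩, ⟨_, Int.add_nonneg (Int.natCast_nonneg _)
          zero_le_one, rfl⟩, F.adj_p _⟩
      · exact congrArg₂ (fun a b => s(a, b)) hgx hgy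
    intro e he
    have : ∃ f : Sym2 Vp, f ∈ (𝒯.posSpan (F.p '' Set.Ici 0)).edgeSet ∧
          ∃ γ : Γ, f.map ((𝒯.toAutPos.comp Γ.subtype) γ) = e := by
      induction e with | _ x y =>
      rcases 𝒯.codist_pos _ _ (F.m 0) he with h1 | h1
      · exact ex x y he h1
      · rw [Sym2.eq_swap]
        exact ex y x he.symm h1.symm
    obtain ⟨f, hf, γ, hγ⟩ := this
    refine ⟨f, ⟨hf, γ, hγ⟩, ?_⟩
    rintro f' ⟨hf', γ', hγ'⟩
    rw [uniq f hf γ, uniq f' hf' γ', hγ, hγ']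

/-! ### The structure of the stabilizers -/

/-- The automorphisms which fix the ray starting at `p j`, the edges at its interior vertices, and
the edges at the vertices `m k` with `k ≤ 0`. -/
def unipotent (F : 𝒯.Frame) (j : ℤ) : Subgroup 𝒯.Aut :=
  fixingSubgroup 𝒯.Aut ({x | ∃ k, j ≤ k ∧ F.p k = x} ∪ {x | ∃ k, j < k ∧ 𝒯.pos.Adj (F.p k) x}) ⊓
    fixingSubgroup 𝒯.Aut {y | ∃ k ≤ 0, 𝒯.neg.Adj (F.m k) y}

theorem mem_unipotent {j : ℤ} {g : 𝒯.Aut} : g ∈ F.unipotent j ↔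
    (∀ k, j ≤ k → g • F.p k = F.p k) ∧ (∀ k, j < k → ∀ x, 𝒯.pos.Adj (F.p k) x → g • x = x) ∧
    ∀ k ≤ 0, ∀ y, 𝒯.neg.Adj (F.m k) y → g • y = y := by
  simp only [unipotent, Subgroup.mem_inf, mem_fixingSubgroup_iff, Set.mem_union, Set.mem_ofPred_eq]
  constructor
  · rintro ⟨h1, h2⟩
    exact ⟨fun k hk => h1 _ (Or.inl ⟨k, hk, rfl⟩), fun k hk x hx => h1 _ (Or.inr ⟨k, hk, hx⟩),
      fun k hk y hy => h2 _ ⟨k, hk, hy⟩⟩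
  · rintro ⟨h1, h2, h3⟩
    refine ⟨?_, ?_⟩
    · rintro _ (⟨k, hk, rfl⟩ | ⟨k, hk, hx⟩)
      · exact h1 k hk
      · exact h2 k hk _ hx
    · rintro _ ⟨k, hk, hy⟩
      exact h3 k hk _ hy

theorem rootGroup_le_unipotent {i j : ℤ} (hi : 0 < i) (hij : i ≤ j) :
    F.rootGroup i ≤ F.unipotent j := by
  intro g hg
  rw [mem_rootGroup] at hg
  rw [mem_unipotent]
  exact ⟨fun k hk => hg.1 k (by omega), fun k hk => hg.2.2.1 k (by omega),
    fun k hk => hg.2.2.2 k (by omega)⟩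

/-- By rigidity. -/
theorem eq_one_of_mem_unipotent (hth : 𝒯.IsThick) {j : ℤ} {g : 𝒯.Aut} (hg : g ∈ F.unipotent j)
    (h : ∀ k, 0 ≤ k → g • F.p k = F.p k) : g = 1 := by
  rw [mem_unipotent] at hg
  have hm0 : g • F.m 0 = F.m 0 := hg.2.2 (-1) (by norm_num) _ (F.adj_m (-1))
  have hm1 : g • F.m (0 + 1) = F.m (0 + 1) := hg.2.2 0 le_rfl _ (F.adj_m 0)
  have hF : F.map g = F := F.map_eq_self (h 0 le_rfl) (h (0 + 1) (by norm_num)) hm0 hm1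
  have hm : ∀ k, g • F.m k = F.m k := fun k => congrArg (fun F : 𝒯.Frame => F.m k) hF
  exact hth.eq_one_of_fixes (F.adj_p (j + 1)) (F.adj_m (j + 1)) (by rw [F.codist_eq]; omega)
    (by rw [F.codist_eq]; omega) (hg.2.1 _ (by omega)) (hg.2.1 _ (by omega)) (hm _) (hm _)

theorem eq_one_of_mem_rootGroup (hth : 𝒯.IsThick) {j : ℤ} {g : 𝒯.Aut} (hg : g ∈ F.rootGroup j)
    (h : g • F.p (j - 1) = F.p (j - 1)) : g = 1 := by
  rw [mem_rootGroup] at hg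
  have hF : F.map g = F := F.map_eq_self (j := j - 1) h (hg.1 _ (by omega))
    (hg.2.1 _ (by omega)) (hg.2.1 _ (by omega))
  have hm : ∀ k, g • F.m k = F.m k := fun k => congrArg (fun F : 𝒯.Frame => F.m k) hF
  exact hth.eq_one_of_fixes (F.adj_p (j + 1)) (F.adj_m (j + 1)) (by rw [F.codist_eq]; omega)
    (by rw [F.codist_eq]; omega) (hg.2.2.1 _ (by omega)) (hg.2.2.1 _ (by omega)) (hm _) (hm _)

theorem productSet_subset_unipotent {i j : ℕ} (hij : i ≤ j) :
    productSet F.rootGroup i ⊆ (F.unipotent j : Set 𝒯.Aut) := by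
  induction i with
  | zero => rintro _ rfl; exact Subgroup.one_mem _
  | succ i ih =>
    rintro _ ⟨a, ha, b, hb, rfl⟩
    exact Subgroup.mul_mem _ (ih (by omega) ha)
      (rootGroup_le_unipotent (by push_cast; omega) (by exact_mod_cast hij) hb)

/-- An automorphism fixing the ray from `p i` on is corrected by `U_i`, then `U_{i-1}`, ..., then
`U_1` to one fixing `p (i - 1)`, then `p (i - 2)`, ..., then `p 0`. -/
theorem Moufang.exists_mem_productSet (hM : F.Moufang) (i : ℕ) (g : 𝒯.Aut)
    (hg : ∀ k : ℤ, i ≤ k → g • F.p k = F.p k) :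
    ∃ w ∈ productSet F.rootGroup i, ∀ k : ℤ, 0 ≤ k → (g * w⁻¹) • F.p k = F.p k := by
  induction i generalizing g with
  | zero => exact ⟨1, rfl, by simpa using hg⟩
  | succ i ih =>
    push_cast at hg
    have hadj : 𝒯.pos.Adj (F.p (i + 1)) (g⁻¹ • F.p i) := by
      rw [adj_inv_smul_pos, hg _ le_rfl]; exact (F.adj_p i).symm
    have hne : g⁻¹ • F.p i ≠ F.p (i + 1 + 1) := fun h => by
      rw [inv_smul_eq_iff, hg _ (by omega)] at h
      have := F.p_injective h
      omega
    obtain ⟨u, hu, hux⟩ := (hM.1 (i + 1)).1 _ hadj hne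
    have hu' := mem_rootGroup.1 hu
    obtain ⟨w, hw, hgw⟩ := ih (g * u) (fun k hk => by
      rcases hk.lt_or_eq with hk | rfl
      · rw [mul_smul, hu'.1 _ (by omega), hg _ (by omega)]
      · rw [add_sub_cancel_right] at hux
        rw [mul_smul, hux, smul_inv_smul])
    refine ⟨w * u⁻¹, Set.mul_mem_mul hw (Subgroup.inv_mem _ (by push_cast; exact hu)), ?_⟩
    rw [mul_inv_rev, inv_inv, ← mul_assoc]
    exact hgw

theorem Moufang.productSet_eq (hM : F.Moufang) (hth : 𝒯.IsThick) (j : ℕ) :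
    productSet F.rootGroup j = (F.unipotent j : Set 𝒯.Aut) := by
  refine (productSet_subset_unipotent le_rfl).antisymm fun g hg => ?_
  obtain ⟨w, hw, hgw⟩ := hM.exists_mem_productSet j g (mem_unipotent.1 hg).1
  have h1 := eq_one_of_mem_unipotent hth
    (Subgroup.mul_mem _ hg (Subgroup.inv_mem _ (productSet_subset_unipotent le_rfl hw))) hgw
  rw [mul_inv_eq_one.1 h1]
  exact hw

theorem smul_edge_eq_iff {g : 𝒯.Aut} (hg : g • F.m 0 = F.m 0) :
    g • ({F.p 0, F.p 1} : Set Vp) = {F.p 0, F.p 1} ↔ g • F.p 0 = F.p 0 ∧ g • F.p 1 = F.p 1 := by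
  rw [show g • ({F.p 0, F.p 1} : Set Vp) = {g • F.p 0, g • F.p 1} from Set.image_pair _ _ _]
  constructor
  · intro h
    have h0 := F.codist_p_zero 0
    have h1 := F.codist_p_zero 1
    simp only [Nat.cast_zero, Nat.cast_one] at h0 h1
    rcases Set.pair_eq_pair_iff.1 h with h | h
    · exact h
    · have := codist_of_fixed_neg hg (F.p 0)
      rw [h.1] at this
      omega
  · rintro ⟨h0, h1⟩
    rw [h0, h1]

theorem IsVertexGroup.mem_edgeStabilizer (h : F.IsVertexGroup Γ) {g : 𝒯.Aut} :
    g ∈ Γ ⊓ MulAction.stabilizer 𝒯.Aut ({F.p 0, F.p 1} : Set Vp) ↔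
      g ∈ Γ ∧ g • F.p 0 = F.p 0 ∧ g • F.p 1 = F.p 1 := by
  rw [Subgroup.mem_inf, MulAction.mem_stabilizer_iff]
  exact and_congr_right fun hg => smul_edge_eq_iff (h.fixes g hg)

/-- The fixator of `p 0`, `p 1` and `m 0` fixes the positive part of the twin root with boundary
`{p 0, m 0}`. -/
theorem smul_p_of_fixes {g : 𝒯.Aut} (hm : g • F.m 0 = F.m 0) (h0 : g • F.p 0 = F.p 0)
    (h1 : g • F.p 1 = F.p 1) {k : ℤ} (hk : 0 ≤ k) : g • F.p k = F.p k := by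
  rcases hk.lt_or_eq with hk | rfl
  · exact F.smul_p_of_le h1 hm zero_lt_one hk
  · exact h0

theorem IsVertexGroup.isInternalSemidirect (h : F.IsVertexGroup Γ) (hM : F.Moufang)
    (hth : 𝒯.IsThick) {j : ℕ} (hj : 0 < j) :
    IsInternalSemidirect (Γ ⊓ MulAction.stabilizer 𝒯.Aut (F.p j))
      (Γ ⊓ MulAction.stabilizer 𝒯.Aut ({F.p 0, F.p 1} : Set Vp)) (F.unipotent j) := by
  have hH : ∀ g ∈ Γ ⊓ MulAction.stabilizer 𝒯.Aut ({F.p 0, F.p 1} : Set Vp),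
      (∀ k, 0 ≤ k → g • F.p k = F.p k) ∧ ∀ k ≤ 0, g • F.m k = F.m k := fun g hg => by
    rw [h.mem_edgeStabilizer] at hg
    obtain ⟨hg, h0, h1⟩ := hg
    exact ⟨fun k hk => smul_p_of_fixes (h.fixes g hg) h0 h1 hk,
      fun k hk => F.smul_m_of_ge h1 (h.fixes g hg) zero_lt_one hk⟩
  have hW : F.unipotent j ≤ Γ := fun g hg => by
    rw [← SetLike.mem_coe, ← hM.productSet_eq hth] at hg
    have : ∀ i : ℕ, productSet F.rootGroup i ⊆ Γ := fun i => by
      induction i with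
      | zero => rintro _ rfl; exact Γ.one_mem
      | succ i ih =>
        rintro _ ⟨a, ha, b, hb, rfl⟩
        exact Γ.mul_mem (ih ha) (h.rootGroup_le _ (by omega) hb)
    exact this j hg
  refine ⟨fun g hg n hn => ?_, ?_, Set.Subset.antisymm ?_ ?_⟩
  · obtain ⟨hp, hm⟩ := hH g hg
    have hp' : ∀ k, 0 ≤ k → g⁻¹ • F.p k = F.p k := fun k hk => by
      rw [inv_smul_eq_iff, hp k hk]
    rw [mem_unipotent] at hn ⊢
    refine ⟨fun k hk => ?_, fun k hk x hx => ?_, fun k hk y hy => ?_⟩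
    · rw [mul_smul, mul_smul, hp' k (by omega), hn.1 k hk, hp k (by omega)]
    · rw [mul_smul, mul_smul, hn.2.1 k hk (g⁻¹ • x), smul_inv_smul]
      rw [adj_inv_smul_pos, hp k (by omega)]; exact hx
    · rw [mul_smul, mul_smul, hn.2.2 k hk (g⁻¹ • y), smul_inv_smul]
      rw [adj_inv_smul_neg, hm k hk]; exact hy
  · rw [Subgroup.disjoint_def]
    exact fun hx hx' => eq_one_of_mem_unipotent hth hx' (hH _ hx).1
  · rintro _ ⟨a, ha, b, hb, rfl⟩
    refine ⟨Γ.mul_mem ha.1 (hW hb), ?_⟩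
    show (a * b) • F.p j = F.p j
    rw [mul_smul, (mem_unipotent.1 hb).1 _ le_rfl, (hH a ha).1 _ (by omega)]
  · rintro g ⟨hg, hgj⟩
    have hgj : g • F.p j = F.p j := hgj
    obtain ⟨w, hw, hgw⟩ := hM.exists_mem_productSet j g
      (fun k hk => F.smul_p_of_le hgj (h.fixes g hg) (by omega) hk)
    rw [hM.productSet_eq hth] at hw
    refine ⟨g * w⁻¹, ?_, w, hw, inv_mul_cancel_right g w⟩
    exact h.mem_edgeStabilizer.2 ⟨Γ.mul_mem hg (Γ.inv_mem (hW hw)), hgw 0 le_rfl,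
      hgw 1 zero_le_one⟩

theorem IsVertexGroup.stabilizer_p_zero (h : F.IsVertexGroup Γ) (hM : F.Moufang)
    (hth : 𝒯.IsThick) : Γ ⊓ MulAction.stabilizer 𝒯.Aut (F.p 0) =
      (Γ ⊓ MulAction.stabilizer 𝒯.Aut ({F.p 0, F.p 1} : Set Vp)) ⊔ F.rootGroup 0 ⊔
        F.reverse.rootGroup 0 := by
  have hU : F.rootGroup 0 ⊔ F.reverse.rootGroup 0 ≤ Γ ⊓ MulAction.stabilizer 𝒯.Aut (F.p 0) :=
    sup_le (le_inf (h.rootGroup_le 0 le_rfl) fun g hg => (mem_rootGroup.1 hg).1 0 le_rfl)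
      (le_inf (h.rootGroup_reverse_le 0 le_rfl) fun g hg => (mem_rootGroup.1 hg).1 0 le_rfl)
  rw [sup_assoc]
  apply le_antisymm
  · intro g hg
    have hg0 : g • F.p 0 = F.p 0 := hg.2
    obtain ⟨k, hk, hkx⟩ := hM.exists_smul_p_one hth (adj_pos_of_fixed hg0 (F.adj_p 0))
    have hk0 : k • F.p 0 = F.p 0 := (hU hk).2
    have : k⁻¹ * g ∈ Γ ⊓ MulAction.stabilizer 𝒯.Aut ({F.p 0, F.p 1} : Set Vp) := by
      rw [h.mem_edgeStabilizer]
      refine ⟨Γ.mul_mem (Γ.inv_mem (hU hk).1) hg.1, ?_, ?_⟩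
      · rw [mul_smul, hg0, inv_smul_eq_iff, hk0]
      · rw [mul_smul, inv_smul_eq_iff]; exact hkx.symm
    rw [← mul_inv_cancel_left k g]
    exact Subgroup.mul_mem _ (Subgroup.mem_sup_right hk) (Subgroup.mem_sup_left this)
  · refine sup_le (fun g hg => ?_) hU
    rw [h.mem_edgeStabilizer] at hg
    exact ⟨hg.1, hg.2.1⟩

/-- By rigidity, an automorphism fixing `m 0` and the neighbours of `p 0` and `p 1` is trivial. -/
theorem eq_one_of_fixes_neighbors (hth : 𝒯.IsThick) {g : 𝒯.Aut} (hm : g • F.m 0 = F.m 0)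
    (h0 : ∀ x, 𝒯.pos.Adj (F.p 0) x → g • x = x) (h1 : ∀ x, 𝒯.pos.Adj (F.p 1) x → g • x = x) :
    g = 1 := by
  have h00 : 𝒯.codist (F.p 0) (F.m 0) = 0 := by rw [F.codist_eq]; rfl
  exact hth.eq_one_of_fixes (F.adj_p 0) (F.adj_m 0) h00 (by rw [F.codist_eq]; rfl) h0 h1 hm
    (fixes_neighbors_neg h00 hm h0 (F.adj_m 0))

/-- The ball of radius `n + 2` around `p n` contains the neighbours of `p 0` and of `p 1`. -/
theorem eq_one_of_fixes_ball (hth : 𝒯.IsThick) {g : 𝒯.Aut} (hm : g • F.m 0 = F.m 0) (n : ℕ)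
    (h : ∀ x, 𝒯.pos.dist (F.p n) x ≤ n + 2 → g • x = x) : g = 1 := by
  have key : ∀ i : ℤ, 0 ≤ i → i ≤ 1 → ∀ x, 𝒯.pos.Adj (F.p i) x → g • x = x := fun i hi hi' x hx =>
    h x <| by
      have h1 := 𝒯.isTree_pos.1.dist_triangle (u := F.p n) (v := F.p i) (w := x)
      have h2 := F.dist_p n i
      have h3 := SimpleGraph.dist_eq_one_iff_adj.2 hx
      omega
  exact eq_one_of_fixes_neighbors hth hm (key 0 le_rfl zero_le_one) (key 1 zero_le_one le_rfl)

theorem finite_of_fixes (hth : 𝒯.IsThick) (hfin : 𝒯.IsLocallyFinite) (n : ℕ) {B : Subgroup 𝒯.Aut}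
    (hm : ∀ g ∈ B, g • F.m 0 = F.m 0) (hp : ∀ g ∈ B, g • F.p n = F.p n) : Finite B := by
  let S : Set Vp := {x | 𝒯.pos.dist (F.p n) x ≤ n + 2}
  have hS : S.Finite := 𝒯.isTree_pos.1.finite_ball hfin.1 _ _
  have : Finite S := hS
  have hmem : ∀ g ∈ B, ∀ x ∈ S, g • x ∈ S := fun g hg x hx => by
    have : 𝒯.pos.dist (F.p n) (g • x) = 𝒯.pos.dist (F.p n) x := by
      conv_lhs => rw [← hp g hg]
      exact dist_smul g _ _
    exact this.trans_le hx
  refine Finite.of_injective (fun (g : B) (x : S) => (⟨g.1 • x.1, hmem g.1 g.2 x.1 x.2⟩ : S)) ?_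
  intro g g' hgg'
  have h1 : g.1⁻¹ * g'.1 = 1 := by
    refine eq_one_of_fixes_ball (F := F) hth ?_ n fun x hx => ?_
    · exact hm _ (B.mul_mem (B.inv_mem g.2) g'.2)
    · have := congrArg Subtype.val (congrFun hgg' ⟨x, hx⟩)
      rw [mul_smul, inv_smul_eq_iff]
      exact this.symm
  exact Subtype.ext (inv_mul_eq_one.1 h1)

end Frame

end TwinTree

/-! ### Rays of groups from actions on trees -/

/-- A locally injective morphism from a connected graph to a tree is injective, since it maps paths
to walks without backtracking, hence to paths. -/
theorem SimpleGraph.Hom.injective_of_locally_injective {V : Type u} {W : Type v}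
    {G : SimpleGraph V} {T : SimpleGraph W} (hG : G.Preconnected) (hT : T.IsAcyclic) (f : G →g T)
    (hf : ∀ a b b', G.Adj a b → G.Adj a b' → f b = f b' → b = b') : Function.Injective f := by
  classical
  have chain : ∀ {a b : V} (p : G.Walk a b), p.IsPath → (p.map f).edges.IsChain (· ≠ ·) := by
    intro a b p
    induction p with
    | nil => intro _; simp
    | @cons a b c h p ih =>
      intro hp
      have hp' := ih hp.of_cons
      cases p with
      | nil => simp
      | @cons _ d _ h' p =>
        simp only [SimpleGraph.Walk.map_cons, SimpleGraph.Walk.edges_cons] at hp' ⊢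
        refine List.IsChain.cons_cons (fun he => ?_) hp'
        have h1 : f a = f d := by
          rcases Sym2.eq_iff.1 he with h2 | h2
          · exact h2.1.trans h2.2
          · exact h2.1
        have h2 := hf b a d h.symm h' h1
        subst h2
        rw [SimpleGraph.Walk.cons_isPath_iff] at hp
        exact hp.2 (by simp)
  intro a b hab
  obtain ⟨p, hp⟩ := (hG a b).exists_isPath
  have h1 := (hT.isPath_iff_isChain (p.map f)).2 (chain p hp)
  have h2 : (p.map f).length = 0 := by
    generalize p.map f = q at h1
    revert q h1
    rw [hab]
    intro q h1
    exact SimpleGraph.Walk.length_eq_zero_iff.2 (SimpleGraph.Walk.isPath_iff_nil.1 h1)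
  rw [SimpleGraph.Walk.length_map] at h2
  exact SimpleGraph.Walk.eq_of_length_eq_zero h2

namespace NagaoRay

variable {P : Type w} [Group P] (D : NagaoRay P)

theorem ι_edge (i : ℕ) (h : P) (he : h ∈ D.edge i) :
    D.ι i ⟨h, D.edge_le_left i he⟩ = D.ι (i + 1) ⟨h, D.edge_le_right i he⟩ := by
  rw [← mul_inv_eq_one, ← map_inv]
  refine (QuotientGroup.eq_one_iff _).2 (Subgroup.subset_normalClosure ⟨i, ⟨h, he⟩, ?_⟩)
  rw [map_inv]; rfl

/-- The homomorphism from the fundamental group to the ambient group that is the inclusion on each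
vertex group. -/
def lift : D.π₁ →* P :=
  QuotientGroup.lift _ (Monoid.CoprodI.lift fun i => (D.vert i).subtype) (by
    refine Subgroup.normalClosure_le_normal ?_
    rintro _ ⟨i, h, rfl⟩
    simp [MonoidHom.mem_ker])

@[simp] theorem lift_ι (i : ℕ) (g : D.vert i) : D.lift (D.ι i g) = g := by
  simp [lift, ι]

theorem vertex_eq_iff {g g' : D.π₁} {i : ℕ} :
    D.vertex g i = D.vertex g' i ↔ ∃ h : D.vert i, g' = g * D.ι i h := by
  simp only [vertex, Sigma.mk.injEq, heq_eq_eq, true_and]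
  rw [QuotientGroup.eq]
  constructor
  · rintro ⟨h, hh⟩; exact ⟨h, by rw [hh]; group⟩
  · rintro ⟨h, rfl⟩; exact ⟨h, by group⟩

theorem smul_vertex (g g' : D.π₁) (i : ℕ) : g • D.vertex g' i = D.vertex (g * g') i := rfl

theorem adj_vertex (g : D.π₁) (i : ℕ) : D.tree.Adj (D.vertex g i) (D.vertex g (i + 1)) :=
  ⟨g, i, Or.inl ⟨rfl, rfl⟩⟩

theorem eq_of_adj_vertex {g : D.π₁} {i : ℕ} {b : D.TreeVertex} (h : D.tree.Adj (D.vertex g i) b) :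
    ∃ k : D.vert i, b = D.vertex (g * D.ι i k) (i + 1) ∨
      ∃ j, i = j + 1 ∧ b = D.vertex (g * D.ι i k) j := by
  obtain ⟨g', j, ⟨h, rfl⟩ | ⟨h, rfl⟩⟩ := h
  · obtain rfl : i = j := congrArg Sigma.fst h
    obtain ⟨k, rfl⟩ := D.vertex_eq_iff.1 h
    exact ⟨k, Or.inl rfl⟩
  · obtain rfl : i = j + 1 := congrArg Sigma.fst h
    obtain ⟨k, rfl⟩ := D.vertex_eq_iff.1 h
    exact ⟨k, Or.inr ⟨j, rfl, rfl⟩⟩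

theorem adj_smul (g : D.π₁) {a b : D.TreeVertex} (h : D.tree.Adj a b) :
    D.tree.Adj (g • a) (g • b) := by
  obtain ⟨g', i, ⟨rfl, rfl⟩ | ⟨rfl, rfl⟩⟩ := h
  · exact ⟨g * g', i, Or.inl ⟨rfl, rfl⟩⟩
  · exact ⟨g * g', i, Or.inr ⟨rfl, rfl⟩⟩

theorem π₁_induction {C : D.π₁ → Prop} (one : C 1)
    (mul : ∀ (i : ℕ) (h : D.vert i) (g : D.π₁), C g → C (D.ι i h * g)) (g : D.π₁) : C g := by
  induction g using QuotientGroup.induction_on with | H z =>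
  induction z using Monoid.CoprodI.induction_left with
  | one => exact one
  | mul m x ih => exact mul _ m _ ih

theorem tree_preconnected : D.tree.Preconnected := by
  have reach : ∀ (g : D.π₁) (i : ℕ), D.tree.Reachable (D.vertex g 0) (D.vertex g i) := by
    intro g i
    induction i with
    | zero => exact SimpleGraph.Reachable.refl _
    | succ i ih => exact ih.trans (D.adj_vertex g i).reachable
  have smul : ∀ (g : D.π₁) (a b : D.TreeVertex), D.tree.Reachable a b →
      D.tree.Reachable (g • a) (g • b) := by
    rintro g a b ⟨w⟩
    induction w with
    | nil => exact SimpleGraph.Reachable.refl _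
    | cons h w ih => exact (D.adj_smul g h).reachable.trans ih
  have base : ∀ g : D.π₁, D.tree.Reachable (D.vertex 1 0) (D.vertex g 0) := by
    refine D.π₁_induction (SimpleGraph.Reachable.refl _) fun i h g ih => ?_
    -- `D.ι i h` fixes the `i`-th vertex of the standard ray
    have h1 : D.vertex (1 : D.π₁) i = D.vertex (D.ι i h) i :=
      D.vertex_eq_iff.2 ⟨h, (one_mul _).symm⟩
    have h2 := smul (D.ι i h) _ _ ih
    rw [smul_vertex, smul_vertex, mul_one] at h2
    exact ((reach 1 i).trans (h1 ▸ (reach _ i).symm)).trans h2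
  have all : ∀ a : D.TreeVertex, D.tree.Reachable (D.vertex 1 0) a := by
    rintro ⟨i, q⟩
    induction q using QuotientGroup.induction_on with | H g =>
    exact (base g).trans (reach g i)
  exact fun a b => (all a).symm.trans (all b)

variable {V : Type u} {T : SimpleGraph V} (ρ : P →* (T ≃g T)) (x : ℕ → V)

/-- The equivariant map from the vertices of the Bass–Serre tree which maps the standard ray to the
ray `x`. -/
def toVertex (hvert : ∀ i, ∀ g ∈ D.vert i, ρ g (x i) = x i) (a : D.TreeVertex) : V :=
  Quotient.liftOn' a.2 (fun g => ρ (D.lift g) (x a.1)) (by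
    intro g g' h
    rw [QuotientGroup.leftRel_apply] at h
    obtain ⟨k, hk⟩ := h
    obtain rfl : g' = g * D.ι a.1 k := by rw [hk]; group
    rw [map_mul, map_mul, lift_ι, RelIso.mul_apply, hvert _ _ k.2])

variable {D ρ x}

/-- The basic case of the structure theorem of Bass and Serre: a group acting on a tree `T` with a
ray as fundamental domain is the fundamental group of the ray of the vertex stabilizers. The
equivariant map from the Bass–Serre tree to `T` is bijective on the neighbours of each vertex; it is
surjective since `T` is connected, and injective since `T` is a tree. -/
theorem realizes_of_isTree (hT : T.IsTree) (hadj : ∀ i, T.Adj (x i) (x (i + 1)))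
    (hvert : ∀ i g, g ∈ D.vert i ↔ ρ g (x i) = x i)
    (hedge : ∀ i g, g ∈ D.vert i → g ∈ D.vert (i + 1) → g ∈ D.edge i)
    (hlevel : ∀ g i j, ρ g (x i) = x j → i = j)
    (hnbr : ∀ i y, T.Adj (x i) y →
      ∃ g ∈ D.vert i, ρ g (x (i + 1)) = y ∨ ∃ j, i = j + 1 ∧ ρ g (x j) = y) :
    D.Realizes ρ x := by
  have hvert' : ∀ i, ∀ g ∈ D.vert i, ρ g (x i) = x i := fun i g => (hvert i g).1
  let Ψ : D.TreeVertex → V := D.toVertex ρ x hvert'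
  have hΨ : ∀ g i, Ψ (D.vertex g i) = ρ (D.lift g) (x i) := fun _ _ => rfl
  have rep : ∀ a : D.TreeVertex, ∃ g i, a = D.vertex g i := by
    rintro ⟨i, q⟩
    induction q using QuotientGroup.induction_on with | H g =>
    exact ⟨g, i, rfl⟩
  have hΨadj : ∀ {a b}, D.tree.Adj a b → T.Adj (Ψ a) (Ψ b) := by
    rintro _ _ ⟨g, i, ⟨rfl, rfl⟩ | ⟨rfl, rfl⟩⟩
    · exact (ρ (D.lift g)).map_rel_iff.2 (hadj i)
    · exact (ρ (D.lift g)).map_rel_iff.2 (hadj i).symm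
  have hsmul : ∀ (g : D.π₁) a, Ψ (g • a) = ρ (D.lift g) (Ψ a) := by
    intro g a
    obtain ⟨g', i, rfl⟩ := rep a
    rw [smul_vertex, hΨ, hΨ, map_mul, map_mul, RelIso.mul_apply]
  have hnbr' : ∀ a y, T.Adj (Ψ a) y → ∃ b, D.tree.Adj a b ∧ Ψ b = y := by
    intro a y hy
    obtain ⟨g, i, rfl⟩ := rep a
    have h1 : T.Adj (x i) ((ρ (D.lift g)).symm y) := by
      rw [← (ρ (D.lift g)).map_adj_iff, RelIso.apply_symm_apply]; exact hy
    obtain ⟨k, hk, h2 | ⟨j, rfl, h2⟩⟩ := hnbr i _ h1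
    · refine ⟨D.vertex (g * D.ι i ⟨k, hk⟩) (i + 1),
        ⟨g * D.ι i ⟨k, hk⟩, i, Or.inl ⟨D.vertex_eq_iff.2 ⟨_, rfl⟩, rfl⟩⟩, ?_⟩
      rw [hΨ, map_mul, map_mul, lift_ι, RelIso.mul_apply]
      exact (congrArg _ h2).trans (RelIso.apply_symm_apply _ _)
    · refine ⟨D.vertex (g * D.ι (j + 1) ⟨k, hk⟩) j,
        ⟨g * D.ι (j + 1) ⟨k, hk⟩, j, Or.inr ⟨D.vertex_eq_iff.2 ⟨_, rfl⟩, rfl⟩⟩, ?_⟩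
      rw [hΨ, map_mul, map_mul, lift_ι, RelIso.mul_apply]
      exact (congrArg _ h2).trans (RelIso.apply_symm_apply _ _)
  have hsurj : Function.Surjective Ψ := by
    intro y
    obtain ⟨w⟩ := hT.1.preconnected (Ψ (D.vertex 1 0)) y
    generalize ha : Ψ (D.vertex 1 0) = z at w
    have : ∃ a, Ψ a = z := ⟨_, ha⟩
    clear ha
    induction w with
    | nil => exact this
    | cons h w ih =>
      obtain ⟨a, rfl⟩ := this
      obtain ⟨b, -, hb⟩ := hnbr' a _ h
      exact ih ⟨b, hb⟩
  have hinj : Function.Injective Ψ := by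
    refine SimpleGraph.Hom.injective_of_locally_injective D.tree_preconnected hT.2
      (⟨Ψ, hΨadj⟩ : D.tree →g T) ?_
    intro a b b' hb hb' h
    have h : Ψ b = Ψ b' := h
    obtain ⟨g, i, rfl⟩ := rep a
    obtain ⟨k, hk⟩ := D.eq_of_adj_vertex hb
    obtain ⟨k', hk'⟩ := D.eq_of_adj_vertex hb'
    -- two elements of a vertex group with the same effect on the next vertex of the ray differ by
    -- an element of the edge group
    have cancel : ∀ j, ρ (D.lift (g * D.ι i k)) (x j) = ρ (D.lift (g * D.ι i k')) (x j) →
        (k⁻¹ * k' : D.vert i).1 ∈ D.vert j := by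
      intro j hj
      rw [hvert]
      simp only [map_mul, lift_ι, RelIso.mul_apply, EmbeddingLike.apply_eq_iff_eq] at hj
      rw [Subgroup.coe_mul, map_mul, RelIso.mul_apply, ← hj, ← RelIso.mul_apply, ← map_mul,
        Subgroup.coe_inv, inv_mul_cancel, map_one, RelIso.one_apply]
    have level : ∀ (g g' : D.π₁) (i j : ℕ), Ψ (D.vertex g i) = Ψ (D.vertex g' j) → i = j := by
      intro g g' i j hij
      refine hlevel (D.lift (g'⁻¹ * g)) i j ?_
      rw [hΨ, hΨ] at hij
      rw [map_mul, map_mul, RelIso.mul_apply, hij, ← RelIso.mul_apply, ← map_mul, ← map_mul,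
        inv_mul_cancel, map_one, map_one, RelIso.one_apply]
    rcases hk with rfl | ⟨j, hj, rfl⟩ <;> rcases hk' with rfl | ⟨j', hj', rfl⟩
    · have h1 := hedge i _ (k⁻¹ * k').2 (cancel _ h)
      refine D.vertex_eq_iff.2 ⟨⟨_, D.edge_le_right i h1⟩, ?_⟩
      rw [← D.ι_edge i _ h1, mul_assoc, ← map_mul]
      congr 2
      exact (mul_inv_cancel_left k k').symm
    · have := level _ _ _ _ h
      omega
    · have := level _ _ _ _ h
      omega
    · subst hj
      obtain rfl : j = j' := by omega
      have h1 := hedge j _ (cancel _ h) (k⁻¹ * k').2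
      refine D.vertex_eq_iff.2 ⟨⟨_, D.edge_le_left j h1⟩, ?_⟩
      rw [D.ι_edge j _ h1, mul_assoc, ← map_mul]
      congr 2
      exact (mul_inv_cancel_left k k').symm
  have hφinj : Function.Injective D.lift := by
    rw [injective_iff_map_eq_one]
    intro g hg
    have h1 : D.vertex 1 0 = D.vertex g 0 := by
      apply hinj
      rw [hΨ, hΨ, hg, map_one]
    obtain ⟨k, rfl⟩ := D.vertex_eq_iff.1 h1
    rw [one_mul] at hg ⊢
    rw [lift_ι] at hg
    rw [show k = 1 from Subtype.ext hg, map_one]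
  have hφsurj : Function.Surjective D.lift := by
    intro γ
    obtain ⟨a, ha⟩ := hsurj (ρ γ (x 0))
    obtain ⟨g, i, rfl⟩ := rep a
    rw [hΨ] at ha
    have h1 : ρ ((D.lift g)⁻¹ * γ) (x 0) = x i := by
      rw [map_mul, RelIso.mul_apply, ← ha, ← RelIso.mul_apply, ← map_mul, inv_mul_cancel, map_one,
        RelIso.one_apply]
    obtain rfl := hlevel _ _ _ h1
    refine ⟨g * D.ι 0 ⟨_, (hvert 0 _).2 h1⟩, ?_⟩
    rw [map_mul, lift_ι, mul_inv_cancel_left]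
  refine ⟨MulEquiv.ofBijective D.lift ⟨hφinj, hφsurj⟩,
    ⟨Equiv.ofBijective Ψ ⟨hinj, hsurj⟩, ?_⟩, fun i g => D.lift_ι i g, fun i => ?_, hsmul⟩
  · intro a b
    refine ⟨fun h => ?_, hΨadj⟩
    obtain ⟨c, hc, hcb⟩ := hnbr' a _ h
    exact hinj hcb ▸ hc
  · show Ψ (D.vertex 1 i) = x i
    rw [hΨ, map_one, map_one, RelIso.one_apply]

/-- The orders of the vertex groups grow exponentially. -/
theorem two_pow_le_card (D : NagaoRay P) (n : ℕ) : 2 ^ n ≤ 2 * Nat.card (D.vert n) := by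
  rcases n with _ | n
  · have := D.finite_vert 0
    have : 0 < Nat.card (D.vert 0) := Nat.card_pos
    omega
  · have : 2 ^ n ≤ Nat.card (D.vert (n + 1)) := by
      induction n with
      | zero =>
        have := D.finite_vert 1
        exact Nat.card_pos
      | succ n ih =>
        have h1 := Subgroup.relIndex_mul_relIndex ⊥ _ _ bot_le (D.vert_le (n + 1) n.succ_pos)
        rw [Subgroup.relIndex_bot_left, Subgroup.relIndex_bot_left] at h1
        have h2 := D.index_succ (n + 1) n.succ_pos
        rw [← h1, pow_succ]
        exact Nat.mul_le_mul ih h2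
    rw [pow_succ]
    omega

end NagaoRay

/-! ### Lattices in the automorphism group of a locally finite graph -/

namespace SimpleGraph

variable {V : Type u} {T : SimpleGraph V}

variable (T) in
/-- The subgroup of the automorphisms of a graph which fix all vertices in `S`. -/
def fixator (S : Set V) : Subgroup (T ≃g T) where
  carrier := {g | ∀ v ∈ S, g v = v}
  one_mem' := fun _ _ => rfl
  mul_mem' := fun {g h} hg hh v hv => by rw [RelIso.mul_apply, hh v hv, hg v hv]
  inv_mem' := fun {g} hg v hv => by
    conv_lhs => rw [← hg v hv]
    exact g.symm_apply_apply v

theorem mem_fixator {S : Set V} {g : T ≃g T} : g ∈ T.fixator S ↔ ∀ v ∈ S, g v = v := Iff.rfl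

theorem mem_fixator_singleton {v : V} {g : T ≃g T} : g ∈ T.fixator {v} ↔ g v = v := by
  simp [mem_fixator]

theorem isOpen_setOf_apply_eq (v w : V) : IsOpen {g : T ≃g T | g v = w} := by
  let _ : TopologicalSpace V := ⊥
  have : DiscreteTopology V := ⟨rfl⟩
  have h : Continuous fun g : T ≃g T => g v :=
    (continuous_apply v).comp continuous_induced_dom
  exact (isOpen_discrete {w}).preimage h

theorem continuous_aut_of_isOpen {X : Type*} [TopologicalSpace X] {f : X → (T ≃g T)}
    (h : ∀ v w, IsOpen {x | f x v = w}) : Continuous f := by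
  let _ : TopologicalSpace V := ⊥
  have : DiscreteTopology V := ⟨rfl⟩
  exact continuous_induced_rng.2 (continuous_pi fun v => continuous_discrete_rng.2 fun w => h v w)

instance : IsTopologicalGroup (T ≃g T) where
  continuous_mul := continuous_aut_of_isOpen fun v w => by
    have : {x : (T ≃g T) × (T ≃g T) | (x.1 * x.2) v = w} =
        ⋃ u, {g : T ≃g T | g u = w} ×ˢ {h : T ≃g T | h v = u} := by
      ext ⟨g, h⟩
      simp [RelIso.mul_apply]
    rw [this]
    exact isOpen_iUnion fun u => (isOpen_setOf_apply_eq u w).prod (isOpen_setOf_apply_eq v u)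
  continuous_inv := continuous_aut_of_isOpen fun v w => by
    have : {g : T ≃g T | g⁻¹ v = w} = {g : T ≃g T | g w = v} := by
      ext g
      exact ⟨fun h => by rw [← show g⁻¹ v = w from h]; exact g.apply_symm_apply v,
        fun h => by rw [← show g w = v from h]; exact g.symm_apply_apply w⟩
    rw [this]
    exact isOpen_setOf_apply_eq w v

instance : BorelSpace (T ≃g T) := ⟨rfl⟩

theorem isOpen_fixator {S : Set V} (hS : S.Finite) : IsOpen (T.fixator S : Set (T ≃g T)) := by
  have : (T.fixator S : Set (T ≃g T)) = ⋂ v ∈ S, {g : T ≃g T | g v = v} := by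
    ext g; simp [mem_fixator]
  rw [this]
  exact hS.isOpen_biInter fun v _ => isOpen_setOf_apply_eq v v

/-- The stabilizer of a vertex of a connected locally finite graph is compact: it is closed in the
compact space of the maps preserving the finite balls around the vertex, because such a map is
surjective if it is injective. -/
theorem Connected.isCompact_fixator (hT : T.Connected) (hf : ∀ x, (T.neighborSet x).Finite)
    (v : V) : IsCompact (T.fixator {v} : Set (T ≃g T)) := by
  let _ : TopologicalSpace V := ⊥
  have : DiscreteTopology V := ⟨rfl⟩
  have hind : Topology.IsInducing (fun g : T ≃g T => (g : V → V)) := ⟨rfl⟩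
  rw [hind.isCompact_iff]
  let B : Set (V → V) := Set.univ.pi fun w => {u | T.dist v u ≤ T.dist v w}
  have hB : IsCompact B := isCompact_univ_pi fun w => (hT.finite_ball hf v _).isCompact
  let C : Set (V → V) := ⋂ (a : V) (b : V),
    {f | (T.Adj (f a) (f b) ↔ T.Adj a b) ∧ (f a = f b → a = b) ∧ f v = v}
  have hC : IsClosed C := by
    refine isClosed_iInter fun a => isClosed_iInter fun b => ?_
    have : Continuous fun f : V → V => (f a, f b, f v) := by fun_prop
    exact (isClosed_discrete {z : V × V × V |
      (T.Adj z.1 z.2.1 ↔ T.Adj a b) ∧ (z.1 = z.2.1 → a = b) ∧ z.2.2 = v}).preimage this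
  convert hB.inter_right hC using 1
  apply Set.Subset.antisymm
  · rintro _ ⟨g, hg, rfl⟩
    have hgv := mem_fixator_singleton.1 hg
    refine ⟨fun w _ => ?_, Set.mem_iInter₂.2 fun a b =>
      ⟨g.map_rel_iff, fun h => g.injective h, hgv⟩⟩
    have := SimpleGraph.Iso.dist_map hT g v w
    rw [hgv] at this
    exact this.le
  · rintro f ⟨hfB, hfC⟩
    have hfC := Set.mem_iInter₂.1 hfC
    have hinj : Function.Injective f := fun a b => (hfC a b).2.1
    have hsurj : Function.Surjective f := by
      intro w
      have hfin : Finite {u | T.dist v u ≤ T.dist v w} := hT.finite_ball hf v _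
      have hmem : ∀ u : {u | T.dist v u ≤ T.dist v w}, f u ∈ {u | T.dist v u ≤ T.dist v w} :=
        fun u =>
          (show T.dist v (f u) ≤ T.dist v u.1 from hfB u.1 trivial).trans u.2
      have : Function.Surjective fun u : {u | T.dist v u ≤ T.dist v w} =>
          (⟨f u, hmem u⟩ : {u | T.dist v u ≤ T.dist v w}) :=
        Finite.surjective_of_injective fun a b h => Subtype.ext (hinj (congrArg Subtype.val h))
      obtain ⟨u, hu⟩ := this ⟨w, le_refl (T.dist v w)⟩
      exact ⟨u, congrArg Subtype.val hu⟩
    refine ⟨⟨Equiv.ofBijective f ⟨hinj, hsurj⟩, fun {a b} => (hfC a b).1⟩, ?_, rfl⟩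
    exact mem_fixator_singleton.2 (hfC v v).2.2

theorem exists_fixator_ball_eq_bot {Λ : Subgroup (T ≃g T)} {v : V}
    (h : Finite (Λ ⊓ T.fixator {v} : Subgroup (T ≃g T))) :
    ∃ n : ℕ, Λ ⊓ T.fixator {w | T.dist v w ≤ n} = ⊥ := by
  have key : ∀ g : (Λ ⊓ T.fixator {v} : Subgroup (T ≃g T)), ∃ w, g.1 w = w → g.1 = 1 := by
    intro g
    by_contra! hg
    exact (hg v).2 (RelIso.ext fun w => (hg w).1)
  choose W hW using key
  obtain ⟨n, hn⟩ := (Set.finite_range fun g => T.dist v (W g)).bddAbove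
  refine ⟨n, (Subgroup.eq_bot_iff_forall _).2 fun g hg => ?_⟩
  have hgv : g ∈ T.fixator {v} := mem_fixator_singleton.2 (hg.2 v (by simp))
  exact hW ⟨g, hg.1, hgv⟩ (hg.2 _ (hn ⟨_, rfl⟩))

/-- A vertex stabilizer in `Λ` being finite, `Λ` meets a small neighbourhood of the identity
trivially. -/
theorem Connected.discreteTopology_of_finite (hT : T.Connected)
    (hf : ∀ x, (T.neighborSet x).Finite) {Λ : Subgroup (T ≃g T)} {v : V}
    (h : Finite (Λ ⊓ T.fixator {v} : Subgroup (T ≃g T))) : DiscreteTopology Λ := by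
  obtain ⟨n, hn⟩ := exists_fixator_ball_eq_bot h
  refine discreteTopology_of_isOpen_singleton_one ?_
  refine ⟨_, isOpen_fixator (hT.finite_ball hf v n), ?_⟩
  ext g
  rw [Set.mem_preimage, Set.mem_singleton_iff]
  constructor
  · intro hg
    have : g.1 ∈ Λ ⊓ T.fixator {w | T.dist v w ≤ n} := ⟨g.2, hg⟩
    rw [hn] at this
    exact Subtype.ext this
  · rintro rfl
    exact Subgroup.one_mem _

/-- The part of a fundamental domain that consists of the automorphisms mapping `v` to `w`: for
each orbit of the group `Λ'` on the cosets of the fixator of the ball of radius `R` around `v`, one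
such coset is chosen. -/
def transversal (Λ' : Subgroup (T ≃g T)) (v w : V) (R : ℕ) : Set (T ≃g T) :=
  {g | g v = w ∧ ∃ k ∈ T.fixator {u | T.dist v u ≤ R},
    g = (DoubleCoset.mk Λ' (T.fixator {u | T.dist v u ≤ R}) g).out * k}

theorem Connected.isOpen_transversal (hT : T.Connected) (hf : ∀ x, (T.neighborSet x).Finite)
    (Λ' : Subgroup (T ≃g T)) (v w : V) (R : ℕ) : IsOpen (transversal Λ' v w R) := by
  rw [isOpen_iff_mem_nhds]
  rintro g ⟨hg, k, hk, hgk⟩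
  have ho := isOpen_fixator (T := T) (hT.finite_ball hf v R)
  have h1 : {h : T ≃g T | g⁻¹ * h ∈ T.fixator {u | T.dist v u ≤ R}} ∈ nhds g :=
    (ho.preimage (continuous_const_mul g⁻¹)).mem_nhds (by
      rw [Set.mem_preimage, inv_mul_cancel]; exact Subgroup.one_mem _)
  refine Filter.mem_of_superset h1 fun h hh => ?_
  obtain ⟨z, rfl⟩ : ∃ z, h = g * z := ⟨g⁻¹ * h, (mul_inv_cancel_left _ _).symm⟩
  have hh : z ∈ T.fixator {u | T.dist v u ≤ R} := by
    have hz : g⁻¹ * (g * z) ∈ T.fixator {u | T.dist v u ≤ R} := hh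
    rwa [inv_mul_cancel_left] at hz
  refine ⟨by rw [RelIso.mul_apply, hh v (by simp), hg], k * z, Subgroup.mul_mem _ hk hh, ?_⟩
  rw [(DoubleCoset.eq Λ' _ (g * z) g).2 ⟨1, Λ'.one_mem, z⁻¹, Subgroup.inv_mem _ hh, by group⟩,
    ← mul_assoc, ← hgk]

theorem exists_mul_mem_transversal {Λ' : Subgroup (T ≃g T)} {v w : V} {R : ℕ}
    (hΛ' : ∀ g ∈ Λ', g w = w) {g : T ≃g T} (hg : g v = w) :
    ∃ γ ∈ Λ', γ * g ∈ transversal Λ' v w R := by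
  obtain ⟨h, k, hh, hk, he⟩ :=
    DoubleCoset.mk_out_eq_mul Λ' (T.fixator {u | T.dist v u ≤ R}) g
  refine ⟨h, hh, by rw [RelIso.mul_apply, hg, hΛ' h hh], k⁻¹, Subgroup.inv_mem _ hk, ?_⟩
  rw [(DoubleCoset.eq Λ' _ (h * g) g).2 ⟨h⁻¹, Λ'.inv_mem hh, 1, Subgroup.one_mem _, by group⟩, he]
  group

theorem Connected.eq_one_of_mem_transversal (hT : T.Connected) {Λ' : Subgroup (T ≃g T)} {v w : V}
    {R : ℕ} (hR : Λ' ⊓ T.fixator {u | T.dist w u ≤ R} = ⊥) {γ g : T ≃g T} (hγ : γ ∈ Λ')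
    (hg : g ∈ transversal Λ' v w R) (hγg : γ * g ∈ transversal Λ' v w R) : γ = 1 := by
  obtain ⟨hgv, k, hk, hgk⟩ := hg
  obtain ⟨-, k', hk', hgk'⟩ := hγg
  rw [(DoubleCoset.eq Λ' _ (γ * g) g).2 ⟨γ⁻¹, Λ'.inv_mem hγ, 1, Subgroup.one_mem _, by group⟩]
    at hgk'
  have h1 : γ = g * (k⁻¹ * k') * g⁻¹ := by
    rw [eq_mul_inv_iff_mul_eq, hgk', ← mul_assoc g, ← eq_mul_inv_iff_mul_eq.2 hgk.symm]
  have h2 : γ ∈ Λ' ⊓ T.fixator {u | T.dist w u ≤ R} := by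
    refine ⟨hγ, fun u hu => ?_⟩
    have h3 : g⁻¹ u ∈ {u | T.dist v u ≤ R} := by
      have h4 := SimpleGraph.Iso.dist_map hT g v (g⁻¹ u)
      rw [hgv, show g (g⁻¹ u) = u from g.apply_symm_apply u] at h4
      exact h4.ge.trans hu
    have h5 := Subgroup.mul_mem _ (Subgroup.inv_mem _ hk) hk' _ h3
    rw [h1, RelIso.mul_apply, RelIso.mul_apply, h5]
    exact g.apply_symm_apply u
  rw [hR] at h2
  exact h2

open MeasureTheory in
/-- The translates of the transversal by the stabilizer of `w` are disjoint subsets of a coset of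
the stabilizer of `v`. -/
theorem Connected.card_mul_measure_transversal_le (hT : T.Connected)
    (hf : ∀ x, (T.neighborSet x).Finite) (μ : Measure (T ≃g T)) [μ.IsHaarMeasure]
    {Λ' : Subgroup (T ≃g T)} [Finite Λ'] {v w : V} {R : ℕ} (hΛ' : ∀ g ∈ Λ', g w = w)
    (hR : Λ' ⊓ T.fixator {u | T.dist w u ≤ R} = ⊥) :
    (Nat.card Λ' : ENNReal) * μ (transversal Λ' v w R) ≤ μ (T.fixator {v}) := by
  rcases (transversal Λ' v w R).eq_empty_or_nonempty with he | ⟨t, ht⟩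
  · simp [he]
  have hopen := hT.isOpen_transversal hf Λ' v w R
  let A : Λ' → Set (T ≃g T) := fun γ => (fun h => (t⁻¹ * γ.1)⁻¹ * h) ⁻¹' transversal Λ' v w R
  have hA : ∀ γ, μ (A γ) = μ (transversal Λ' v w R) := fun γ => measure_preimage_mul μ _ _
  have hAm : ∀ γ, MeasurableSet (A γ) := fun γ =>
    (hopen.preimage (continuous_const_mul _)).measurableSet
  have hdis : Pairwise (Function.onFun Disjoint A) := by
    intro γ γ' hne
    refine Set.disjoint_left.2 fun h hh hh' => hne ?_
    have hh : (t⁻¹ * γ.1)⁻¹ * h ∈ transversal Λ' v w R := hh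
    have hh' : (t⁻¹ * γ'.1)⁻¹ * h ∈ transversal Λ' v w R := hh'
    have h1 := hT.eq_one_of_mem_transversal hR (γ := γ'.1⁻¹ * γ.1)
      (Λ'.mul_mem (Λ'.inv_mem γ'.2) γ.2) hh (by convert hh' using 1; group)
    exact Subtype.ext (inv_mul_eq_one.1 h1).symm
  have hsub : ⋃ γ, A γ ⊆ T.fixator {v} := by
    refine Set.iUnion_subset fun γ h hh => mem_fixator_singleton.2 ?_
    have h1 : ((t⁻¹ * γ.1)⁻¹ * h) v = w := hh.1
    have h2 : h = t⁻¹ * γ.1 * ((t⁻¹ * γ.1)⁻¹ * h) := (mul_inv_cancel_left _ _).symm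
    rw [h2, RelIso.mul_apply, h1, RelIso.mul_apply, hΛ' _ γ.2, ← ht.1]
    exact t.symm_apply_apply v
  have := Fintype.ofFinite Λ'
  calc (Nat.card Λ' : ENNReal) * μ (transversal Λ' v w R) = ∑' γ, μ (A γ) := by
        simp only [hA, tsum_fintype, Finset.sum_const, Finset.card_univ, nsmul_eq_mul,
          Nat.card_eq_fintype_card]
    _ = μ (⋃ γ, A γ) := (measure_iUnion hdis hAm).symm
    _ ≤ μ (T.fixator {v}) := measure_mono hsub

open MeasureTheory in
/-- A group of automorphisms with the vertices of the sequence `x` as representatives of its orbits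
is a lattice if the orders of the stabilizers of these vertices grow exponentially. -/
theorem Connected.isTreeLattice (hT : T.Connected) (hf : ∀ x, (T.neighborSet x).Finite)
    (Λ : Subgroup (T ≃g T)) (x : ℕ → V) (hcov : ∀ v, ∃ γ ∈ Λ, ∃ n, γ (x n) = v)
    (hlevel : ∀ γ ∈ Λ, ∀ i j, γ (x i) = x j → i = j)
    (hfin : ∀ n, Finite (Λ ⊓ T.fixator {x n} : Subgroup (T ≃g T)))
    (hcard : ∀ n, 2 ^ n ≤ 2 * Nat.card (Λ ⊓ T.fixator {x n} : Subgroup (T ≃g T))) :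
    IsTreeLattice T Λ := by
  refine ⟨hT.discreteTopology_of_finite hf (hfin 0), ?_⟩
  have hcpt := hT.isCompact_fixator hf (x 0)
  have ho : IsOpen (T.fixator {x 0} : Set (T ≃g T)) := isOpen_fixator (Set.finite_singleton _)
  let K₀ : TopologicalSpace.PositiveCompacts (T ≃g T) :=
    ⟨⟨T.fixator {x 0}, hcpt⟩, ⟨1, by
      show (1 : T ≃g T) ∈ interior (T.fixator {x 0} : Set (T ≃g T))
      rw [ho.interior_eq]; exact Subgroup.one_mem _⟩⟩
  let μ := Measure.haarMeasure K₀
  choose R hR using fun n => exists_fixator_ball_eq_bot (hfin n)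
  let Λ' : ℕ → Subgroup (T ≃g T) := fun n => Λ ⊓ T.fixator {x n}
  let F : ℕ → Set (T ≃g T) := fun n => transversal (Λ' n) (x 0) (x n) (R n)
  have hΛ' : ∀ n, ∀ g ∈ Λ' n, g (x n) = x n := fun n g hg => mem_fixator_singleton.1 hg.2
  have hR' : ∀ n, Λ' n ⊓ T.fixator {u | T.dist (x n) u ≤ R n} = ⊥ := fun n =>
    le_bot_iff.1 ((inf_le_inf_right _ inf_le_left).trans (hR n).le)
  refine ⟨μ, inferInstance, ⋃ n, F n, ⟨?_, ?_, ?_⟩, ?_⟩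
  · exact (isOpen_iUnion fun n => hT.isOpen_transversal hf _ _ _ _).measurableSet.nullMeasurableSet
  · refine Filter.Eventually.of_forall fun g => ?_
    obtain ⟨γ, hγ, n, hn⟩ := hcov (g (x 0))
    have h1 : (γ⁻¹ * g) (x 0) = x n := by
      rw [RelIso.mul_apply, ← hn]; exact γ.symm_apply_apply _
    obtain ⟨δ, hδ, h2⟩ := exists_mul_mem_transversal (R := R n) (hΛ' n) h1
    refine ⟨⟨δ * γ⁻¹, Λ.mul_mem hδ.1 (Λ.inv_mem hγ)⟩, Set.mem_iUnion.2 ⟨n, ?_⟩⟩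
    show δ * γ⁻¹ * g ∈ F n
    rw [mul_assoc]; exact h2
  · intro γ γ' hne
    refine Disjoint.aedisjoint (Set.disjoint_left.2 ?_)
    rintro _ ⟨a, ha, rfl⟩ ⟨b, hb, hab⟩
    have hab : γ'.1 * b = γ.1 * a := hab
    obtain ⟨n, hn⟩ := Set.mem_iUnion.1 ha
    obtain ⟨m, hm⟩ := Set.mem_iUnion.1 hb
    have hb' : b = γ'.1⁻¹ * γ.1 * a := by rw [mul_assoc, ← hab, inv_mul_cancel_left]
    have hδ : γ'.1⁻¹ * γ.1 ∈ Λ := Λ.mul_mem (Λ.inv_mem γ'.2) γ.2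
    have hnm : (γ'.1⁻¹ * γ.1) (x n) = x m := by
      rw [← hn.1, ← hm.1, hb', RelIso.mul_apply _ a]
    obtain rfl := hlevel _ hδ n m hnm
    have h1 := hT.eq_one_of_mem_transversal (hR' n) (γ := γ'.1⁻¹ * γ.1)
      ⟨hδ, mem_fixator_singleton.2 hnm⟩ hn (hb' ▸ hm)
    exact hne (Subtype.ext (inv_mul_eq_one.1 h1).symm)
  · have hle : ∀ n, μ (F n) ≤ 2 * μ (T.fixator {x 0}) * (2⁻¹ : ENNReal) ^ n := by
      intro n
      have : Finite (Λ' n) := hfin n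
      have h1 := hT.card_mul_measure_transversal_le hf μ (v := x 0) (hΛ' n) (hR' n)
      have h2 : (2 : ENNReal) ^ n ≤ 2 * (Nat.card (Λ' n) : ENNReal) := by exact_mod_cast hcard n
      have h3 : (2 : ENNReal) ^ n * μ (F n) ≤ 2 * μ (T.fixator {x 0}) :=
        calc (2 : ENNReal) ^ n * μ (F n) ≤ 2 * (Nat.card (Λ' n) : ENNReal) * μ (F n) := by gcongr
          _ = 2 * ((Nat.card (Λ' n) : ENNReal) * μ (F n)) := mul_assoc _ _ _
          _ ≤ _ := by gcongr
      rw [← ENNReal.inv_pow, ← div_eq_mul_inv, ENNReal.le_div_iff_mul_le (by simp) (by simp),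
        mul_comm]
      exact h3
    calc μ (⋃ n, F n) ≤ ∑' n, μ (F n) := measure_iUnion_le _
      _ ≤ ∑' n, 2 * μ (T.fixator {x 0}) * (2⁻¹ : ENNReal) ^ n := ENNReal.tsum_le_tsum hle
      _ < ⊤ := by
        rw [ENNReal.tsum_mul_left, ENNReal.tsum_geometric, ENNReal.one_sub_inv_two, inv_inv]
        exact ENNReal.mul_lt_top (ENNReal.mul_lt_top (by simp) hcpt.measure_lt_top) (by simp)

end SimpleGraph

/-! ### The ray of groups of a twin apartment -/

theorem Subgroup.le_relIndex_of_transitive {G : Type w} {α : Type u} [Group G] [MulAction G α]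
    {H K : Subgroup G} [Finite K] {x : α} {s : Set α} {n : ℕ} (hs : n ≤ s.encard)
    (hH : ∀ k ∈ K, k ∈ H ↔ k • x = x) (htrans : ∀ y ∈ s, ∃ k ∈ K, k • x = y) :
    n ≤ H.relIndex K := by
  have h1 : H.subgroupOf K = MulAction.stabilizer K x := by
    ext k
    rw [Subgroup.mem_subgroupOf, MulAction.mem_stabilizer_iff]
    exact hH k k.2
  rw [Subgroup.relIndex, h1, MulAction.index_stabilizer]
  have hfin : (MulAction.orbit K x).Finite := Set.finite_range _
  have h2 : s ⊆ MulAction.orbit K x := fun y hy => by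
    obtain ⟨k, hk, rfl⟩ := htrans y hy
    exact ⟨⟨k, hk⟩, rfl⟩
  have h3 := hs.trans (Set.encard_le_encard h2)
  rw [← hfin.cast_ncard_eq] at h3
  exact_mod_cast h3

theorem IsInternalSemidirect.subgroupOf {P : Type w} [Group P] {K H W Γ : Subgroup P}
    (h : IsInternalSemidirect K H W) (hK : K ≤ Γ) :
    IsInternalSemidirect (K.subgroupOf Γ) (H.subgroupOf Γ) (W.subgroupOf Γ) := by
  obtain ⟨h1, h2, h3⟩ := h
  refine ⟨fun a ha b hb => h1 _ ha _ hb, ?_, Set.Subset.antisymm ?_ ?_⟩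
  · rw [Subgroup.disjoint_def] at h2 ⊢
    exact fun ha hb => Subtype.ext (h2 ha hb)
  · rintro _ ⟨a, ha, b, hb, rfl⟩
    exact h3.subset ⟨a.1, ha, b.1, hb, rfl⟩
  · intro g hg
    obtain ⟨a, ha, b, hb, hab⟩ := h3.superset hg
    have ha' : a ∈ Γ := hK (h3.subset ⟨a, ha, 1, W.one_mem, mul_one a⟩)
    have hb' : b ∈ Γ := hK (h3.subset ⟨1, H.one_mem, b, hb, one_mul b⟩)
    exact ⟨⟨a, ha'⟩, ha, ⟨b, hb'⟩, hb, Subtype.ext hab⟩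

/-- Commuting subgroups are independent if their product map is injective. -/
theorem Subgroup.iSupIndep_of_injective_noncommPiCoprod {G : Type w} [Group G] {ι : Type}
    [Fintype ι] [DecidableEq ι] {U : ι → Subgroup G}
    (hcomm : Pairwise fun i j => ∀ a b, a ∈ U i → b ∈ U j → Commute a b)
    (h : Function.Injective (Subgroup.noncommPiCoprod hcomm)) : iSupIndep U := by
  intro j
  have hle : ⨆ (i) (_ : i ≠ j), U i ≤
      ((Pi.evalMonoidHom (fun i => U i) j).ker).map (Subgroup.noncommPiCoprod hcomm) := by
    refine iSup₂_le fun i hij a ha => ⟨Pi.mulSingle i ⟨a, ha⟩, ?_, ?_⟩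
    · exact Pi.mulSingle_eq_of_ne hij.symm _
    · exact Subgroup.noncommPiCoprod_mulSingle i _
  refine (Subgroup.disjoint_def.2 fun {a} ha ha' => ?_ : Disjoint (U j) _).mono_right hle
  obtain ⟨f, hf, hfa⟩ := ha'
  have h1 : f = Pi.mulSingle j ⟨a, ha⟩ :=
    h (hfa.trans (Subgroup.noncommPiCoprod_mulSingle (hcomm := hcomm) j ⟨a, ha⟩).symm)
  have hf : f j = 1 := hf
  rw [h1, Pi.mulSingle_eq_same] at hf
  exact congrArg Subtype.val hf

namespace TwinTree

variable {Vp : Type u} {Vm : Type v} {𝒯 : TwinTree Vp Vm}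

namespace Frame

variable {F : 𝒯.Frame} {Γ : Subgroup 𝒯.Aut}

theorem stabilizer_eq_subgroupOf {α : Type u} [MulAction 𝒯.Aut α] (Γ : Subgroup 𝒯.Aut) (x : α) :
    MulAction.stabilizer Γ x = (Γ ⊓ MulAction.stabilizer 𝒯.Aut x).subgroupOf Γ := by
  ext g
  rw [Subgroup.mem_subgroupOf, Subgroup.mem_inf]
  exact ⟨fun h => ⟨g.2, h⟩, fun h => h.2⟩

theorem IsVertexGroup.finite_stabilizer (h : F.IsVertexGroup Γ) (hth : 𝒯.IsThick)
    (hfin : 𝒯.IsLocallyFinite) (n : ℕ) :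
    Finite ↥(Γ ⊓ MulAction.stabilizer 𝒯.Aut (F.p n)) :=
  finite_of_fixes hth hfin n (fun g hg => h.fixes g hg.1) fun _ hg => hg.2

theorem _root_.TwinTree.IsThick.two_le_encard (hth : 𝒯.IsThick) (x a : Vp) :
    2 ≤ {y | 𝒯.pos.Adj x y ∧ y ≠ a}.encard := by
  obtain ⟨c, hc, hca, -⟩ := hth.exists_adj_pos x a a
  obtain ⟨d, hd, hda, hdc⟩ := hth.exists_adj_pos x a c
  rw [← Set.encard_pair hdc]
  exact Set.encard_le_encard (Set.pair_subset ⟨hd, hda⟩ ⟨hc, hca⟩)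

/-- The ray of the stabilizers in `Γ` of the vertices `p i` with `i ≥ 0`. -/
def IsVertexGroup.nagaoRay (h : F.IsVertexGroup Γ) (hM : F.Moufang) (hth : 𝒯.IsThick)
    (hfin : 𝒯.IsLocallyFinite) : NagaoRay Γ :=
  have hfinite : ∀ i : ℕ, Finite (MulAction.stabilizer Γ (F.p i)) := fun i => by
    have := h.finite_stabilizer hth hfin i
    rw [stabilizer_eq_subgroupOf]
    exact Finite.of_injective
      (fun g => (⟨g.1.1, g.2⟩ : ↥(Γ ⊓ MulAction.stabilizer 𝒯.Aut (F.p i))))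
      fun a b hab => Subtype.ext (Subtype.ext (Subtype.mk.inj hab))
  have hH0 : ∀ g : Γ, g ∈ MulAction.stabilizer Γ ({F.p 0, F.p 1} : Set Vp) ↔
      g • F.p 0 = F.p 0 ∧ g • F.p 1 = F.p 1 := fun g => smul_edge_eq_iff (h.fixes g g.2)
  have hle : ∀ i : ℕ, 0 < i → ∀ g : Γ, g • F.p i = F.p i → ∀ k : ℤ, i ≤ k → g • F.p k = F.p k :=
    fun _ hi g hg _ hk => F.smul_p_of_le (g := g.1) hg (h.fixes g g.2) (by omega) hk
  have htrans : ∀ i : ℕ, ∀ y ∈ {y | 𝒯.pos.Adj (F.p (i + 1)) y ∧ y ≠ F.p (i + 1 + 1)},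
      ∃ k ∈ MulAction.stabilizer Γ (F.p (i + 1 : ℕ)), k • F.p i = y := fun i y hy => by
    obtain ⟨k, hk, hky⟩ := (hM.1 (i + 1)).1 y hy.1 hy.2
    rw [add_sub_cancel_right] at hky
    exact ⟨⟨k, h.rootGroup_le _ (by omega) hk⟩, (mem_rootGroup.1 hk).1 _ (by push_cast; omega), hky⟩
  { vert i := MulAction.stabilizer Γ (F.p i)
    H0 := MulAction.stabilizer Γ ({F.p 0, F.p 1} : Set Vp)
    H0_le_zero := fun g hg => ((hH0 g).1 hg).1
    H0_le_one := fun g hg => ((hH0 g).1 hg).2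
    vert_le := fun i hi g hg => hle i hi g hg _ (by omega)
    finite_vert := hfinite
    index_zero := by
      have := hfinite 0
      have h3 : 3 ≤ (MulAction.stabilizer Γ ({F.p 0, F.p 1} : Set Vp)).relIndex
          (MulAction.stabilizer Γ (F.p (0 : ℕ))) := by
        refine Subgroup.le_relIndex_of_transitive (x := F.p 1)
          (by exact_mod_cast hth.1 (F.p 0)) (fun k hk => ?_) fun y hy => ?_
        · exact (hH0 k).trans ⟨fun h => h.2, fun h => ⟨hk, h⟩⟩
        · obtain ⟨k, hk, hky⟩ := hM.exists_smul_p_one hth hy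
          have hk' : k ∈ Γ ⊓ MulAction.stabilizer 𝒯.Aut (F.p 0) := by
            rw [h.stabilizer_p_zero hM hth, sup_assoc]
            exact Subgroup.mem_sup_right hk
          exact ⟨⟨k, hk'.1⟩, hk'.2, hky⟩
      omega
    index_one := by
      have := hfinite 1
      refine Subgroup.le_relIndex_of_transitive (x := F.p 0)
        (by exact_mod_cast hth.two_le_encard (F.p 1) (F.p (1 + 1))) (fun k hk => ?_) ?_
      · exact (hH0 k).trans ⟨fun h => h.1, fun h => ⟨h, hk⟩⟩
      · simpa using htrans 0
    index_succ := fun i hi => by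
      have := hfinite (i + 1)
      refine Subgroup.le_relIndex_of_transitive (x := F.p i)
        (by exact_mod_cast hth.two_le_encard (F.p (i + 1)) (F.p (i + 1 + 1))) (fun k _ => ?_)
        (htrans i)
      exact MulAction.mem_stabilizer_iff }

theorem IsVertexGroup.realizes (h : F.IsVertexGroup Γ) (hM : F.Moufang) (hth : 𝒯.IsThick)
    (hfin : 𝒯.IsLocallyFinite) :
    (h.nagaoRay hM hth hfin).Realizes (𝒯.toAutPos.comp Γ.subtype) fun i : ℕ => F.p i := by
  refine NagaoRay.realizes_of_isTree 𝒯.isTree_pos (fun i => by push_cast; exact F.adj_p i)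
    (fun i g => Iff.rfl) ?_ ?_ ?_
  · rintro (_ | i) g h0 h1
    · exact (smul_edge_eq_iff (h.fixes g g.2)).2 ⟨h0, h1⟩
    · exact h0
  · intro g i j hij
    have h1 := h.codist_smul g.2 (F.p i)
    have h2 : (g : 𝒯.Aut) • F.p i = F.p j := hij
    rw [h2, F.codist_p_zero, F.codist_p_zero] at h1
    exact h1.symm
  · rintro (_ | i) y hy
    · obtain ⟨k, hk, hky⟩ := hM.exists_smul_p_one hth hy
      have hk' : k ∈ Γ ⊓ MulAction.stabilizer 𝒯.Aut (F.p 0) := by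
        rw [h.stabilizer_p_zero hM hth, sup_assoc]
        exact Subgroup.mem_sup_right hk
      exact ⟨⟨k, hk'.1⟩, hk'.2, Or.inl hky⟩
    · push_cast at hy
      by_cases hne : y = F.p (i + 1 + 1)
      · exact ⟨1, Subgroup.one_mem _, Or.inl (by rw [hne]; push_cast; rfl)⟩
      · obtain ⟨k, hk, hky⟩ := (hM.1 (i + 1)).1 y hy hne
        rw [add_sub_cancel_right] at hky
        exact ⟨⟨k, h.rootGroup_le _ (by omega) hk⟩,
          (mem_rootGroup.1 hk).1 _ (by push_cast; omega), Or.inr ⟨i, rfl, hky⟩⟩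

theorem IsVertexGroup.injective (h : F.IsVertexGroup Γ) (hth : 𝒯.IsThick) :
    Function.Injective (𝒯.toAutPos.comp Γ.subtype) := by
  rw [injective_iff_map_eq_one]
  intro g hg
  have hx : ∀ x : Vp, (g : 𝒯.Aut) • x = x := fun x => DFunLike.congr_fun hg x
  exact Subtype.ext (eq_one_of_fixes_neighbors hth (h.fixes g g.2) (fun x _ => hx x)
    fun x _ => hx x)

theorem IsVertexGroup.isTreeLattice (h : F.IsVertexGroup Γ) (hM : F.Moufang) (hth : 𝒯.IsThick)
    (hfin : 𝒯.IsLocallyFinite) : IsTreeLattice 𝒯.pos (𝒯.toAutPos.comp Γ.subtype).range := by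
  have hmap : ∀ n : ℕ, (𝒯.toAutPos.comp Γ.subtype).range ⊓ 𝒯.pos.fixator {F.p n} =
      ((h.nagaoRay hM hth hfin).vert n).map (𝒯.toAutPos.comp Γ.subtype) := by
    intro n
    ext g
    constructor
    · rintro ⟨⟨γ, rfl⟩, hγ⟩
      exact ⟨γ, SimpleGraph.mem_fixator_singleton.1 hγ, rfl⟩
    · rintro ⟨γ, hγ, rfl⟩
      exact ⟨⟨γ, rfl⟩, SimpleGraph.mem_fixator_singleton.2 hγ⟩
  refine 𝒯.isTree_pos.1.isTreeLattice hfin.1 _ (fun n : ℕ => F.p n) (fun v => ?_) ?_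
    (fun n => ?_) fun n => ?_
  · obtain ⟨g, hg, hgv⟩ := h.exists_smul_p hM hth v
    exact ⟨_, ⟨⟨g, hg⟩, rfl⟩, _, hgv⟩
  · rintro _ ⟨g, rfl⟩ i j hij
    have h1 := h.codist_smul g.2 (F.p i)
    have h2 : (g : 𝒯.Aut) • F.p i = F.p j := hij
    rw [h2, F.codist_p_zero, F.codist_p_zero] at h1
    exact h1.symm
  · have := (h.nagaoRay hM hth hfin).finite_vert n
    rw [hmap]
    exact Finite.of_equiv _ (Subgroup.equivMapOfInjective _ _ (h.injective hth)).toEquiv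
  · rw [hmap, ← Nat.card_congr (Subgroup.equivMapOfInjective _ _ (h.injective hth)).toEquiv]
    exact (h.nagaoRay hM hth hfin).two_pow_le_card n

/-! ### Commuting root groups -/

theorem _root_.TwinTree.SatisfiesComm.commute (hC : 𝒯.SatisfiesComm) (F : 𝒯.Frame) {i j : ℤ}
    (hij : i ≠ j) {a b : 𝒯.Aut} (ha : a ∈ F.rootGroup i) (hb : b ∈ F.rootGroup j) :
    Commute a b := by
  refine hC F.apartment F.numbering F.numbering i j (fun h => hij ?_) ?_ a ha b hb
  · have key : ∀ i j, F.numbering.root i = F.numbering.root j → j ≤ i := fun i j h => by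
      have h1 : F.p i ∈ (F.numbering.root j).1 := h ▸ ⟨i, le_refl i, rfl⟩
      obtain ⟨k, hk, hki⟩ := h1
      rw [← F.p_injective hki]
      exact hk
    exact le_antisymm (key j i h.symm) (key i j h)
  · rcases le_total i j with h | h
    · exact Or.inr (Set.image_mono (Set.Ici_subset_Ici.2 h))
    · exact Or.inl (Set.image_mono (Set.Ici_subset_Ici.2 h))

/-- Under the condition (Comm), an automorphism that fixes `m 0`, `p 0` and `p 1` normalizes each
`U_j` with `j > 0`: it is the product of an element of `U_0` and an automorphism fixing the frame. -/
theorem Moufang.conj_mem_rootGroup_of_comm (hM : F.Moufang) (hC : 𝒯.SatisfiesComm) {g : 𝒯.Aut}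
    (hm : g • F.m 0 = F.m 0) (h0 : g • F.p 0 = F.p 0) (h1 : g • F.p 1 = F.p 1) {j : ℤ}
    (hj : 0 < j) {a : 𝒯.Aut} (ha : a ∈ F.rootGroup j) : g * a * g⁻¹ ∈ F.rootGroup j := by
  have hm' : g • F.m (0 - 1) = F.m (0 - 1) := F.smul_m_of_ge h1 hm zero_lt_one (by norm_num)
  obtain ⟨u, hu, hux⟩ := (hM.1 0).2 (g • F.m (0 + 1)) (adj_neg_of_fixed hm (F.adj_m 0))
    (fun h => by
      rw [← hm'] at h
      exact absurd (F.m_injective (smul_left_cancel g h)) (by norm_num))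
  have hu' := mem_rootGroup.1 hu
  have ht : F.map (u⁻¹ * g) = F := by
    refine F.map_eq_self (j := 0) ?_ ?_ ?_ ?_
    · rw [mul_smul, h0, inv_smul_eq_iff, hu'.1 0 le_rfl]
    · rw [mul_smul, inv_smul_eq_iff, hu'.1 (0 + 1) (by norm_num)]; exact h1
    · rw [mul_smul, hm, inv_smul_eq_iff, hu'.2.1 0 le_rfl]
    · rw [mul_smul, inv_smul_eq_iff, hux]
  have h2 := conj_mem_rootGroup ha (u⁻¹ * g)
  rw [ht] at h2
  have h3 := (hC.commute F hj.ne hu h2).eq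
  have h4 : g * a * g⁻¹ = u * (u⁻¹ * g * a * (u⁻¹ * g)⁻¹) * u⁻¹ := by group
  rw [h4, h3, mul_inv_cancel_right]
  exact h2

theorem IsVertexGroup.isInternalDirectProduct (h : F.IsVertexGroup Γ) (hM : F.Moufang)
    (hth : 𝒯.IsThick) (hC : 𝒯.SatisfiesComm) (n : ℕ) :
    IsInternalDirectProduct (fun j : Fin n => (F.rootGroup ((j : ℕ) + 1 : ℕ)).subgroupOf Γ)
      ((F.unipotent n).subgroupOf Γ) := by
  have hcomm : Pairwise fun i j : Fin n => ∀ a b : Γ,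
      a ∈ (F.rootGroup ((i : ℕ) + 1 : ℕ)).subgroupOf Γ →
      b ∈ (F.rootGroup ((j : ℕ) + 1 : ℕ)).subgroupOf Γ → Commute a b := fun i j hij a b ha hb =>
    Subtype.ext (hC.commute F (fun h => hij (Fin.ext (by omega))) ha hb)
  refine ⟨fun i j hij a ha b hb => hcomm hij a b ha hb, ?_, le_antisymm ?_ ?_⟩
  · refine Subgroup.iSupIndep_of_injective_noncommPiCoprod hcomm ?_
    rw [injective_iff_map_eq_one]
    intro f hf
    -- the last nontrivial factor of a trivial product fixes `p i`, as the other ones do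
    have key : ∀ k : ℕ, ∀ i : Fin n, n ≤ i + k → f i = 1 := by
      intro k
      induction k with
      | zero => intro i hi; omega
      | succ k ih =>
        intro i hi
        have hdec : f = Function.update f i 1 * Pi.mulSingle i (f i) := by
          funext l
          by_cases hl : l = i
          · subst hl; simp
          · simp [hl]
        have hfix : Subgroup.noncommPiCoprod hcomm (Function.update f i 1) ∈
            MulAction.stabilizer Γ (F.p i) := by
          rw [Subgroup.noncommPiCoprod_apply]
          refine Subgroup.noncommProd_mem _ _ fun l _ => ?_
          by_cases hl : l = i
          · subst hl; simp
          · rw [Function.update_of_ne hl]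
            rcases lt_or_gt_of_ne hl with hl | hl
            · exact (mem_rootGroup.1 (f l).2).1 i (by exact_mod_cast hl)
            · rw [ih l (by omega)]
              exact Subgroup.one_mem _
        rw [hdec, map_mul, Subgroup.noncommPiCoprod_mulSingle] at hf
        have h2 : ((f i : Γ) : 𝒯.Aut) • F.p i = F.p i := by
          have h3 : (f i : Γ) ∈ MulAction.stabilizer Γ (F.p i) := by
            rw [← inv_eq_of_mul_eq_one_right hf]
            exact Subgroup.inv_mem _ hfix
          exact h3
        refine Subtype.ext (Subtype.ext (eq_one_of_mem_rootGroup hth (f i).2 ?_))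
        push_cast
        rw [add_sub_cancel_right]
        exact h2
    exact funext fun i => key n i (by omega)
  · refine iSup_le fun i a ha => ?_
    exact rootGroup_le_unipotent (by push_cast; omega) (by have := i.2; push_cast; omega) ha
  · have key : ∀ k ≤ n, ∀ g ∈ productSet F.rootGroup k, ∃ hg : g ∈ Γ, (⟨g, hg⟩ : Γ) ∈
        ⨆ j : Fin n, (F.rootGroup ((j : ℕ) + 1 : ℕ)).subgroupOf Γ := by
      intro k
      induction k with
      | zero => rintro - _ rfl; exact ⟨Γ.one_mem, Subgroup.one_mem _⟩
      | succ k ih =>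
        rintro hk _ ⟨a, ha, b, hb, rfl⟩
        obtain ⟨ha, ha'⟩ := ih (by omega) a ha
        have hbΓ := h.rootGroup_le _ (by omega) hb
        exact ⟨Γ.mul_mem ha hbΓ, Subgroup.mul_mem _ ha' (Subgroup.mem_iSup_of_mem
          (⟨k, by omega⟩ : Fin n) (show (⟨b, hbΓ⟩ : Γ) ∈ _ from hb))⟩
    intro g hg
    have hg' : g.1 ∈ productSet F.rootGroup n := by
      rw [hM.productSet_eq hth]; exact hg
    exact (key n le_rfl _ hg').2

theorem IsVertexGroup.isDirectlySplit (h : F.IsVertexGroup Γ) (hM : F.Moufang) (hth : 𝒯.IsThick)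
    (hfin : 𝒯.IsLocallyFinite) (hC : 𝒯.SatisfiesComm) :
    (h.nagaoRay hM hth hfin).IsDirectlySplit := by
  refine ⟨fun j => (F.rootGroup j).subgroupOf Γ, fun j hj => ⟨fun a ha => ?_, fun g hg a ha => ?_⟩,
    fun i hi => ⟨(F.unipotent i).subgroupOf Γ, h.isInternalDirectProduct hM hth hC i, ?_⟩⟩
  · exact (mem_rootGroup.1 ha).1 j le_rfl
  · obtain ⟨h0, h1⟩ := (smul_edge_eq_iff (h.fixes g g.2)).1 hg
    exact hM.conj_mem_rootGroup_of_comm hC (h.fixes g g.2) h0 h1 (by omega) ha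
  · have := (h.isInternalSemidirect hM hth hi).subgroupOf inf_le_left
    rw [← stabilizer_eq_subgroupOf, ← stabilizer_eq_subgroupOf] at this
    exact this

end Frame

theorem TwinApartment.Numbering.isVertexGroup {L : 𝒯.TwinApartment} (N : L.Numbering) :
    N.toFrame.IsVertexGroup (𝒯.rootSubgroup ⊓ MulAction.stabilizer 𝒯.Aut (N.m 0)) := by
  have hle : ∀ (N : L.Numbering) (j : ℤ), N.rootGroup j ≤ 𝒯.rootSubgroup := fun N j =>
    le_iSup_of_le L (le_iSup_of_le N (le_iSup_of_le j le_rfl))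
  refine ⟨fun g hg => hg.2, fun j hj => le_inf (hle N j) fun g hg => ?_,
    fun j hj => le_inf (hle N.reverse j) fun g hg => ?_⟩
  · exact (Frame.mem_rootGroup.1 hg).2.1 0 hj
  · exact (Frame.mem_rootGroup.1 hg).2.1 0 hj

end TwinTree

theorem mainTheorem9 {Vp : Type u} {Vm : Type v} (𝒯 : TwinTree Vp Vm)
    (hthick : 𝒯.IsThick) (hfin : 𝒯.IsLocallyFinite) (hMoufang : 𝒯.IsMoufang)
    (L : 𝒯.TwinApartment) (N : L.Numbering)
    (Γ : Subgroup 𝒯.Aut) (hΓ : Γ = 𝒯.rootSubgroup ⊓ MulAction.stabilizer 𝒯.Aut (N.m 0))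
    (ρ : Γ →* (𝒯.pos ≃g 𝒯.pos)) (hρ : ρ = 𝒯.toAutPos.comp Γ.subtype)
    (Eplus : Set Vp) (hE : Eplus = {N.p 0, N.p 1})
    (H₀ : Subgroup 𝒯.Aut) (hH₀ : H₀ = Γ ⊓ MulAction.stabilizer 𝒯.Aut Eplus) :
    -- both rays from `v_+` are fundamental domains
    (IsTreeFundamentalDomain ρ (𝒯.posSpan (N.p '' Set.Ici 0)) ∧
      IsTreeFundamentalDomain ρ (𝒯.posSpan (N.p '' Set.Iic 0))) ∧
    -- the structure of the stabilizers
    (Finite ↥(MulAction.stabilizer 𝒯.Aut Eplus ⊓ MulAction.stabilizer 𝒯.Aut (N.m 0)) ∧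
      Finite H₀ ∧
      (∀ j : ℕ, 0 < j → ∃ W : Subgroup 𝒯.Aut,
        (W : Set 𝒯.Aut) = productSet N.rootGroup j ∧
        IsInternalSemidirect (Γ ⊓ MulAction.stabilizer 𝒯.Aut (N.p j)) H₀ W) ∧
      Finite ↥(Γ ⊓ MulAction.stabilizer 𝒯.Aut (N.p 0)) ∧
      Γ ⊓ MulAction.stabilizer 𝒯.Aut (N.p 0) =
        H₀ ⊔ N.rootGroup 0 ⊔ N.reverse.rootGroup 0) ∧
    -- `Γ` and its action are those attached to the ray of stabilizers
    (∃ D : NagaoRay Γ,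
      (∀ i : ℕ, D.vert i = MulAction.stabilizer Γ (N.p i)) ∧
      D.H0 = MulAction.stabilizer Γ Eplus ∧
      D.Realizes ρ (fun i : ℕ => N.p i)) ∧
    -- `Γ` is a lattice of Nagao type, directly split under (Comm)
    (IsTreeLattice 𝒯.pos ρ.range ∧ IsNagaoType ρ ∧
      (𝒯.SatisfiesComm → IsDirectlySplitNagaoType ρ)) ∧
    -- the level function is the codistance from `v_-`
    (∀ (x : Vp) (i : ℕ), HasLevel ρ (fun j : ℕ => N.p j) x i ↔ 𝒯.codist x (N.m 0) = i) := by

  have hM := hMoufang.moufang N.toFrame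
  have h : N.toFrame.IsVertexGroup Γ := hΓ ▸ N.isVertexGroup
  subst hρ hE hH₀
  refine ⟨⟨h.isTreeFundamentalDomain hM hthick, ?_⟩, ⟨?_, ?_, fun j hj => ?_, ?_, ?_⟩,
    ⟨h.nagaoRay hM hthick hfin, fun _ => rfl, rfl, h.realizes hM hthick hfin⟩,
    ⟨h.isTreeLattice hM hthick hfin, ⟨_, _, h.realizes hM hthick hfin⟩, fun hC =>
      ⟨_, _, h.realizes hM hthick hfin, h.isDirectlySplit hM hthick hfin hC⟩⟩, fun x i => ?_⟩
  · have hset : N.p '' Set.Iic 0 = N.toFrame.reverse.p '' Set.Ici 0 := by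
      ext x
      constructor
      · rintro ⟨k, hk, rfl⟩
        exact ⟨-k, Set.mem_Ici.2 (neg_nonneg.2 hk), congrArg N.p (neg_neg k)⟩
      · rintro ⟨k, hk, rfl⟩
        exact ⟨-k, Set.mem_Iic.2 (neg_nonpos.2 hk), rfl⟩
    rw [hset]
    exact h.reverse.isTreeFundamentalDomain hM.reverse hthick
  · exact TwinTree.Frame.finite_of_fixes (F := N.toFrame) hthick hfin 0 (fun g hg => hg.2) fun g hg =>
      ((TwinTree.Frame.smul_edge_eq_iff (F := N.toFrame) hg.2).1 hg.1).1
  · exact TwinTree.Frame.finite_of_fixes (F := N.toFrame) hthick hfin 0 (fun g hg => h.fixes g hg.1)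
      fun g hg => (h.mem_edgeStabilizer.1 hg).2.1
  · exact ⟨N.toFrame.unipotent j, (hM.productSet_eq hthick j).symm,
      h.isInternalSemidirect hM hthick hj⟩
  · exact h.finite_stabilizer hthick hfin 0
  · exact h.stabilizer_p_zero hM hthick
  · constructor
    · rintro ⟨γ, rfl⟩
      exact (h.codist_smul γ.2 _).trans (N.toFrame.codist_p_zero i)
    · rintro rfl
      obtain ⟨g, hg, hgx⟩ := h.exists_smul_p hM hthick x
      exact ⟨⟨g, hg⟩, hgx⟩
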